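/- Let $M$ be a (Hausdorff) $C^1$ manifold without boundary, of dimension $d\ge 2$ and not necessarily compact, whose tangent bundle carries a Finsler norm, i.e. a norm $\|\cdot\|_x$ on each tangent space $T_xM$ that depends continuously on the base point. Equip $M$ with the associated distance (the infimum of the lengths of $C^1$ paths; it is $+\infty$ between different connected components of $M$), and let "Lipschitz" mean Lipschitz with respect to this distance. Let $f:M\to M$ be a $C^1$ map, not necessarily injective, and let $\Lambda\subseteq M$ be a compact set with $f(\Lambda)=\Lambda$. Assume that $\Lambda$ is *hyperbolic*: there are integers $d^u,d^s\ge1$ with $d=d^u+d^s$, constants $\lambda^s<0<\lambda^u$ and $C\ge1$, and a splitting $T_xM=E^u(x)\oplus E^s(x)$ for $x\in\Lambda$, where $E^u(x)$ and $E^s(x)$ have dimensions $d^u$ and $d^s$ and depend continuously on $x\in\Lambda$, such that for all $x\in\Lambda$ and $n\ge0$ $$T_xf(E^u(x))=E^u(f(x)),\qquad T_xf(E^s(x))\subseteq E^s(f(x)),$$ $$\|T_xf^n(v)\|\le C e^{n\lambda^s}\|v\|\ \ (v\in E^s(x)),\qquad \|T_xf^n(v)\|\ge C^{-1}e^{n\lambda^u}\|v\|\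 \ (v\in E^u(x)).$$ Assume that $\Lambda$ is *locally maximal*: there is an open neighbourhood $U$ of $\Lambda$ with compact closure such that $\bigcap_{n\in\mathbb Z}f^n(\overline U)=\Lambda$, where for $n<0$ the set $f^{n}(\overline U)$ is the preimage of $\overline U$ under $f^{|n|}$. Let $\varphi:M\to\mathbb R$ be Lipschitz, and assume that the Birkhoff sum of $\varphi$ over every periodic orbit in $\Lambda$ is non-negative: $\sum_{k=0}^{n-1}\varphi(f^k(p))\ge0$ whenever $p\in\Lambda$, $n\ge1$ and $f^n(p)=p$. Then there exist an open neighbourhood $\Omega$ of $\Lambda$ and a Lipschitz function $u:M\to\mathbb R$ such that $$\varphi(x)-u(f(x))+u(x)\ge0\qquad\text{for all }x\in\Omega.$$ -/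

import Mathlib

open Set Topology
open scoped Manifold NNReal ENNReal

/-- A Finsler norm on a `C¹` manifold `M` of dimension `d` without boundary: a norm on each tangent
space, depending continuously on the base point (that is, jointly continuous on `TM`). -/
structure FinslerNorm (d : ℕ) (M : Type*) [TopologicalSpace M]
    [ChartedSpace (EuclideanSpace ℝ (Fin d)) M] [IsManifold (𝓡 d) 1 M] where
  /-- The norm on the tangent space at `x`. -/
  norm : ∀ x : M, Seminorm ℝ (TangentSpace (𝓡 d) x)
  pos : ∀ (x : M) (v : TangentSpace (𝓡 d) x), v ≠ 0 → 0 < norm x v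
  continuous : Continuous fun p : TangentBundle (𝓡 d) M => norm p.1 p.2

namespace FinslerNorm

variable {d : ℕ} {M : Type*} [TopologicalSpace M]
  [ChartedSpace (EuclideanSpace ℝ (Fin d)) M] [IsManifold (𝓡 d) 1 M]

/-- The distance associated to the Finsler norm: the infimum of the lengths
`∫₀¹ ‖γ'(t)‖ dt` over the `C¹` paths `γ` from `x` to `y`. It is `∞` if there is no such path,
i.e. if `x` and `y` lie in different connected components. -/
noncomputable def finslerEDist (F : FinslerNorm d M) (x y : M) : ℝ≥0∞ :=
  letI : ∀ z : M, ENorm (TangentSpace (𝓡 d) z) := fun z => ⟨fun v => ENNReal.ofReal (F.norm z v)⟩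
  Manifold.riemannianEDist (𝓡 d) x y

/-- A real function on `M` is Lipschitz continuous for the Finsler distance. -/
def IsLipschitz (F : FinslerNorm d M) (g : M → ℝ) : Prop :=
  ∃ K : ℝ≥0, ∀ x y : M, edist (g x) (g y) ≤ K * F.finslerEDist x y

end FinslerNorm

section Dynamics

variable {d : ℕ} {M : Type*} [TopologicalSpace M]
  [ChartedSpace (EuclideanSpace ℝ (Fin d)) M] [IsManifold (𝓡 d) 1 M]

/-- `x ↦ V x` is a continuous map from `Λ` to the bundle of `k`-dimensional subspaces of the
tangent spaces: near each point of `Λ`, the subspaces `V x` have a basis depending continuously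
on `x ∈ Λ`. -/
def IsContinuousSubbundleOn (Λ : Set M) (k : ℕ)
    (V : ∀ x : M, Submodule ℝ (TangentSpace (𝓡 d) x)) : Prop :=
  ∀ x₀ ∈ Λ, ∃ W ∈ 𝓝 x₀, ∃ s : Fin k → ∀ x : M, TangentSpace (𝓡 d) x,
    (∀ i, ContinuousOn (fun x => (⟨x, s i x⟩ : TangentBundle (𝓡 d) M)) (W ∩ Λ)) ∧
    ∀ x ∈ W ∩ Λ, LinearIndependent ℝ (fun i => s i x) ∧
      Submodule.span ℝ (range fun i => s i x) = V x

/-- `Λ` is a compact hyperbolic set of the (not necessarily injective) map `f`. -/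
def IsHyperbolicSet (F : FinslerNorm d M) (f : M → M) (Λ : Set M) : Prop :=
  IsCompact Λ ∧ f '' Λ = Λ ∧
  ∃ (du ds : ℕ) (lu ls C : ℝ) (Eu Es : ∀ x : M, Submodule ℝ (TangentSpace (𝓡 d) x)),
    1 ≤ du ∧ 1 ≤ ds ∧ d = du + ds ∧ ls < 0 ∧ 0 < lu ∧ 1 ≤ C ∧
    IsContinuousSubbundleOn Λ du Eu ∧ IsContinuousSubbundleOn Λ ds Es ∧
    ∀ x ∈ Λ,
      IsCompl (Eu x) (Es x) ∧
      (mfderiv (𝓡 d) (𝓡 d) f x) '' (Eu x : Set (TangentSpace (𝓡 d) x)) = Eu (f x) ∧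
      (∀ v ∈ Es x, mfderiv (𝓡 d) (𝓡 d) f x v ∈ Es (f x)) ∧
      ∀ n : ℕ,
        (∀ v ∈ Es x, F.norm (f^[n] x) (mfderiv (𝓡 d) (𝓡 d) (f^[n]) x v) ≤
          C * Real.exp (n * ls) * F.norm x v) ∧
        (∀ v ∈ Eu x, C⁻¹ * Real.exp (n * lu) * F.norm x v ≤
          F.norm (f^[n] x) (mfderiv (𝓡 d) (𝓡 d) (f^[n]) x v))

end Dynamics

/-- `Λ` is locally maximal: `⋂_{n ∈ ℤ} fⁿ(closure U) = Λ` for some open neighbourhood `U` of `Λ` of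
compact closure. As `f` need not be invertible, `fⁿ(A)` is the image of `A` under the `n`-th iterate
for `n ≥ 0`, and the preimage of `A` under the `|n|`-th iterate for `n ≤ 0`. -/
def IsLocallyMaximal {M : Type*} [TopologicalSpace M] (f : M → M) (Λ : Set M) : Prop :=
  ∃ U : Set M, IsOpen U ∧ Λ ⊆ U ∧ IsCompact (closure U) ∧
    (⋂ n : ℕ, f^[n] '' closure U) ∩ (⋂ n : ℕ, f^[n] ⁻¹' closure U) = Λ

/-! The function `u` is an infimum of penalized sums over pseudo-orbits. For a chain `x 0, …, x m`
in `Ω`, add `φ` along the chain, `C` times each jump from `f (x i)` to `x (i + 1)`, and `C` times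
the final jump from `f (x m)` to `y`; `u y` is the infimum over all chains. It is Lipschitz in `y`,
and appending `x` to a chain aimed at `x` gives `u (f x) ≤ u x + φ x`. What must be proved is that
chain sums are bounded below (`exists_subaction_of_chain_sums_bounded`).

For closed chains with small jumps, the bound is 0. Such a chain is shadowed by periodic orbits in
`Λ`, where the Birkhoff sums of `φ` are non-negative, and the total shadowing error is at most a
constant times the sum of the jumps. The penalty absorbs this error
(`exists_closed_chain_sum_nonneg`). The estimate on sums is essential: a uniform bound on the
distances would give an error proportional to the length of the chain. For open chains, cut out
loops by pigeonhole on finitely many small cells, and let each large jump pay for a restart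
(`exists_chain_sum_lower_bound`).

The shadowing is a fixed point argument on cyclic sequences. Unstable coordinates are solved
backwards by inverting the expansion, stable ones are read off from the predecessor in the cycle, so
`f` itself is never inverted. Summing the fixed point equations over the cycle gives the error
bound. Everything is done for an iterate `f^[N]` whose hyperbolicity beats the distortion of the
coordinates.

Distances are measured through a bounded `C¹` map `Θ` into a normed space, built from cut-off
charts. It is Lipschitz for the Finsler distance, so a function Lipschitz in `Θ` is Lipschitz on all
of `M`. Near `Λ` it controls the charts, hence also `φ` and the iterates of `f`, and it avoids
infinite distances between components. -/

/-! ### Abstract shadowing along a permutation -/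

/-- A cyclic shadowing lemma: maps `G i` close to block-hyperbolic linear maps, arranged along a
permutation `θ`, have a common orbit near zero, with an `ℓ¹` estimate. -/
theorem exists_orbit_of_near_hyperbolic {ι U S : Type*} [Fintype ι]
    [NormedAddCommGroup U] [NormedSpace ℝ U] [FiniteDimensional ℝ U]
    [NormedAddCommGroup S] [NormedSpace ℝ S] [FiniteDimensional ℝ S]
    (θ : Equiv.Perm ι) (Au : ι → U →ₗ[ℝ] U) (As : ι → S →ₗ[ℝ] S)
    (hAu : ∀ i a, 4 * ‖a‖ ≤ ‖Au i a‖) (hAs : ∀ i b, ‖As i b‖ ≤ ‖b‖ / 4)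
    (G : ι → U × S → U × S) {r : ℝ} (hr : 0 < r)
    (hG : ∀ i v w, ‖v‖ ≤ r → ‖w‖ ≤ r →
      ‖G i v - G i w - (Au i (v - w).1, As i (v - w).2)‖ ≤ ‖v - w‖ / 4)
    (h0 : ∀ i, ‖G i 0‖ ≤ r / 2) :
    ∃ v : ι → U × S, (∀ i, ‖v i‖ ≤ r) ∧ (∀ i, G i (v i) = v (θ i)) ∧
      ∑ i, ‖v i‖ ≤ 7 * ∑ i, ‖G i 0‖ := by
  have inj : ∀ i, Function.Injective (Au i) := by
    intro i
    rw [injective_iff_map_eq_zero]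
    intro a ha
    have := hAu i a
    rw [ha, norm_zero] at this
    exact norm_le_zero_iff.1 (by linarith)
  let e : ∀ i, U ≃ₗ[ℝ] U := fun i => LinearEquiv.ofInjectiveEndo (Au i) (inj i)
  have he : ∀ i a, e i a = Au i a := fun i a => by
    simp [e]
  have hes : ∀ i a, ‖(e i).symm a‖ ≤ ‖a‖ / 4 := by
    intro i a
    have := hAu i ((e i).symm a)
    rw [← he, LinearEquiv.apply_symm_apply] at this
    linarith
  have hG1 : ∀ i v w, ‖v‖ ≤ r → ‖w‖ ≤ r →
      ‖(G i v).1 - (G i w).1 - Au i (v.1 - w.1)‖ ≤ ‖v - w‖ / 4 := fun i v w hv hw =>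
    (norm_fst_le (G i v - G i w - (Au i (v - w).1, As i (v - w).2))).trans (hG i v w hv hw)
  have hG2 : ∀ i v w, ‖v‖ ≤ r → ‖w‖ ≤ r →
      ‖(G i v).2 - (G i w).2‖ ≤ ‖v - w‖ / 4 + ‖(v - w).2‖ / 4 := by
    intro i v w hv hw
    have h1 : ‖(G i v).2 - (G i w).2 - As i (v.2 - w.2)‖ ≤ ‖v - w‖ / 4 :=
      (norm_snd_le (G i v - G i w - (Au i (v - w).1, As i (v - w).2))).trans (hG i v w hv hw)
    have h2 := hAs i (v.2 - w.2)
    calc ‖(G i v).2 - (G i w).2‖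
        = ‖((G i v).2 - (G i w).2 - As i (v.2 - w.2)) + As i (v.2 - w.2)‖ := by
          rw [sub_add_cancel]
      _ ≤ _ := (norm_add_le _ _).trans (add_le_add h1 h2)
  -- Fixed points of `T` are the orbits sought. The unstable part at `i` solves the equation towards
  -- `θ i` through the inverse of `Au i`; the stable part is the image of the point at `θ.symm i`,
  -- so `As` need not be invertible.
  let T : (ι → U × S) → (ι → U × S) := fun v i =>
    ((e i).symm ((v (θ i)).1 - ((G i (v i)).1 - Au i (v i).1)), (G (θ.symm i) (v (θ.symm i))).2)
  let s : Set (ι → U × S) := Metric.closedBall 0 r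
  have hs : ∀ v ∈ s, ∀ i, ‖v i‖ ≤ r := fun v hv i =>
    (norm_le_pi_norm v i).trans (by simpa [s] using hv)
  -- The unstable component contracts by `(1 + 1/4)/4`, the stable one by `1/4 + 1/4`; hence the
  -- factor `1/2`.
  have hT : ∀ v ∈ s, ∀ w ∈ s, ‖T v - T w‖ ≤ 1 / 2 * ‖v - w‖ := by
    intro v hv w hw
    rw [pi_norm_le_iff_of_nonneg (by positivity)]
    intro i
    have hn : ∀ j, ‖v j - w j‖ ≤ ‖v - w‖ := fun j => norm_le_pi_norm (v - w) j
    rw [Pi.sub_apply, norm_prod_le_iff]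
    constructor
    · change ‖(e i).symm _ - (e i).symm _‖ ≤ _
      rw [← map_sub]
      refine (hes i _).trans ?_
      have h1 := hG1 i _ _ (hs v hv i) (hs w hw i)
      have h2 := hn i
      have h3 : ‖(v (θ i)).1 - (w (θ i)).1‖ ≤ ‖v - w‖ := (norm_fst_le (v (θ i) - w (θ i))).trans (hn _)
      have h4 : ‖((v (θ i)).1 - (w (θ i)).1) -
          ((G i (v i)).1 - (G i (w i)).1 - Au i ((v i).1 - (w i).1))‖ ≤ ‖v - w‖ + ‖v - w‖ / 4 :=
        (norm_sub_le _ _).trans (by linarith)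
      rw [map_sub] at h4
      have h5 : (v (θ i)).1 - ((G i (v i)).1 - Au i (v i).1) -
          ((w (θ i)).1 - ((G i (w i)).1 - Au i (w i).1)) = ((v (θ i)).1 - (w (θ i)).1) -
          ((G i (v i)).1 - (G i (w i)).1 - (Au i (v i).1 - Au i (w i).1)) := by abel
      rw [h5]
      have := norm_nonneg (v - w)
      linarith
    · change ‖(G (θ.symm i) (v (θ.symm i))).2 - (G (θ.symm i) (w (θ.symm i))).2‖ ≤ _
      refine (hG2 _ _ _ (hs v hv _) (hs w hw _)).trans ?_
      have h2 := hn (θ.symm i)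
      have h3 := norm_snd_le (v (θ.symm i) - w (θ.symm i))
      linarith
  have hT0 : ‖T 0‖ ≤ r / 2 := by
    rw [pi_norm_le_iff_of_nonneg (by positivity)]
    intro i
    rw [norm_prod_le_iff]
    constructor
    · refine (hes i _).trans ?_
      have := (norm_fst_le (G i 0)).trans (h0 i)
      simp only [Pi.zero_apply, Prod.fst_zero, map_zero, sub_zero, zero_sub, norm_neg]
      linarith
    · exact (norm_snd_le (G (θ.symm i) 0)).trans (h0 _)
  have hmem0 : (0 : ι → U × S) ∈ s := by simp [s, hr.le]
  have hmaps : MapsTo T s s := by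
    intro v hv
    have h1 := hT v hv 0 hmem0
    have h2 : ‖v‖ ≤ r := by simpa [s] using hv
    have h3 : ‖T v‖ ≤ ‖T v - T 0‖ + ‖T 0‖ := by
      simpa using norm_add_le (T v - T 0) (T 0)
    rw [sub_zero] at h1
    simp only [s, mem_closedBall_zero_iff]
    linarith
  have hcomplete : IsComplete s := (Metric.isClosed_closedBall).isComplete
  have hcontr : ContractingWith (1 / 2) (hmaps.restrict T s s) := by
    refine ⟨by norm_num [← NNReal.coe_lt_coe], LipschitzWith.of_dist_le_mul ?_⟩
    rintro ⟨v, hv⟩ ⟨w, hw⟩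
    have := hT v hv w hw
    simpa [Subtype.dist_eq, dist_eq_norm] using this
  obtain ⟨v, hv, hfix, -⟩ := hcontr.exists_fixedPoint' hcomplete hmaps hmem0 (edist_ne_top _ _)
  have hfix' : ∀ i, T v i = v i := fun i => congrFun hfix i
  have hf1 : ∀ i, (e i).symm ((v (θ i)).1 - ((G i (v i)).1 - Au i (v i).1)) = (v i).1 := fun i =>
    congrArg Prod.fst (hfix' i)
  have hf2 : ∀ i, (G i (v i)).2 = (v (θ i)).2 := fun i => by
    have := congrArg Prod.snd (hfix' (θ i))
    simpa [T] using this
  refine ⟨v, hs v hv, ?_, ?_⟩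
  · intro i
    refine Prod.ext ?_ (hf2 i)
    have := hf1 i
    rw [LinearEquiv.symm_apply_eq, he] at this
    have h6 : (v (θ i)).1 - (G i (v i)).1 = 0 := by
      have h7 : (v (θ i)).1 - ((G i (v i)).1 - Au i (v i).1) =
        ((v (θ i)).1 - (G i (v i)).1) + Au i (v i).1 := by abel
      rw [h7] at this
      simpa using this
    exact (sub_eq_zero.1 h6).symm
  · have hz : ‖(0 : U × S)‖ ≤ r := by simpa using hr.le
    -- The sup norm of the fixed point says nothing about sums. The fixed point equations are
    -- therefore estimated term by term and summed, using that reindexing by `θ` preserves sums.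
    have b1 : ∀ i, ‖(v i).1‖ ≤ (‖v (θ i)‖ + ‖G i 0‖ + ‖v i‖ / 4) / 4 := by
      intro i
      rw [← hf1 i]
      refine (hes i _).trans ?_
      have h1 := hG1 i _ _ (hs v hv i) hz
      have h2 := norm_fst_le (G i 0)
      have h3 := norm_fst_le (v (θ i))
      simp only [Prod.fst_zero, sub_zero] at h1
      have h5 : (v (θ i)).1 - ((G i (v i)).1 - Au i (v i).1) =
        (v (θ i)).1 - (G i 0).1 - ((G i (v i)).1 - (G i 0).1 - Au i (v i).1) := by abel
      have h6 := norm_sub_le ((v (θ i)).1 - (G i 0).1) ((G i (v i)).1 - (G i 0).1 - Au i (v i).1)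
      have h7 := norm_sub_le (v (θ i)).1 (G i 0).1
      rw [h5]
      linarith
    have b2 : ∀ i, ‖(v (θ i)).2‖ ≤ ‖G i 0‖ + ‖v i‖ / 2 := by
      intro i
      rw [← hf2 i]
      have h1 := hG2 i _ _ (hs v hv i) hz
      have h2 := norm_snd_le (G i 0)
      simp only [sub_zero] at h1
      have h3 := norm_snd_le (v i)
      have h4 := norm_add_le ((G i (v i)).2 - (G i 0).2) (G i 0).2
      rw [sub_add_cancel] at h4
      linarith
    -- With `S = ∑ ‖v i‖` and `E = ∑ ‖G i 0‖`, the two bounds add up to `S ≤ (13/16) S + (5/4) E`,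
    -- that is `S ≤ (20/3) E ≤ 7 E`.
    have s1 : ∑ i, ‖(v i).1‖ ≤ (∑ i, ‖v i‖ + ∑ i, ‖G i 0‖ + (∑ i, ‖v i‖) / 4) / 4 := by
      refine (Finset.sum_le_sum fun i _ => b1 i).trans_eq ?_
      rw [← Finset.sum_div, Finset.sum_add_distrib, Finset.sum_add_distrib, ← Finset.sum_div,
        Equiv.sum_comp θ fun i => ‖v i‖]
    have s2 : ∑ i, ‖(v i).2‖ ≤ ∑ i, ‖G i 0‖ + (∑ i, ‖v i‖) / 2 := by
      rw [← Equiv.sum_comp θ fun i => ‖(v i).2‖]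
      refine (Finset.sum_le_sum fun i _ => b2 i).trans_eq ?_
      rw [Finset.sum_add_distrib, ← Finset.sum_div]
    have s3 : ∑ i, ‖v i‖ ≤ ∑ i, ‖(v i).1‖ + ∑ i, ‖(v i).2‖ := by
      rw [← Finset.sum_add_distrib]
      refine Finset.sum_le_sum fun i _ => ?_
      rw [Prod.norm_def]
      exact max_le (by linarith [norm_nonneg (v i).2]) (by linarith [norm_nonneg (v i).1])
    have := Finset.sum_nonneg fun i (_ : i ∈ Finset.univ) => norm_nonneg (v i)
    linarith

/-! ### Sub-actions from chains, and lower bounds for chain sums -/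

section Chains

variable {M Y : Type*} [PseudoMetricSpace Y]

/-- A function whose chain sums are bounded below admits a Lipschitz sub-action. -/
theorem exists_subaction_of_chain_sums_bounded (Θ : M → Y) (f : M → M) (φ : M → ℝ) {Ω : Set M}
    (hΩ : Ω.Nonempty) {C B : ℝ} (hC : 0 ≤ C)
    (hB : ∀ (m : ℕ) (x : ℕ → M), (∀ i ≤ m, x i ∈ Ω) →
      -B ≤ ∑ i ∈ Finset.range m, (φ (x i) + C * dist (Θ (f (x i))) (Θ (x (i + 1)))) + φ (x m)) :
    ∃ u : M → ℝ, (∀ x y, |u x - u y| ≤ C * dist (Θ x) (Θ y)) ∧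
      ∀ x ∈ Ω, u (f x) ≤ u x + φ x := by
  let I := {p : ℕ × (ℕ → M) // ∀ i ≤ p.1, p.2 i ∈ Ω}
  obtain ⟨x₀, hx₀⟩ := hΩ
  have : Nonempty I := ⟨⟨(0, fun _ => x₀), fun _ _ => hx₀⟩⟩
  let V : I → M → ℝ := fun p y => ∑ i ∈ Finset.range p.1.1,
    (φ (p.1.2 i) + C * dist (Θ (f (p.1.2 i))) (Θ (p.1.2 (i + 1)))) + φ (p.1.2 p.1.1) +
      C * dist (Θ (f (p.1.2 p.1.1))) (Θ y)
  have hV : ∀ y, BddBelow (range fun p => V p y) := by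
    intro y
    refine ⟨-B, ?_⟩
    rintro _ ⟨p, rfl⟩
    have h1 := hB p.1.1 p.1.2 p.2
    have h2 : 0 ≤ C * dist (Θ (f (p.1.2 p.1.1))) (Θ y) := by positivity
    simp only [V]
    linarith
  have hlip : ∀ x y, (⨅ p, V p x) ≤ (⨅ p, V p y) + C * dist (Θ x) (Θ y) := by
    intro x y
    rw [← sub_le_iff_le_add]
    refine le_ciInf fun p => ?_
    rw [sub_le_iff_le_add]
    refine (ciInf_le (hV x) p).trans ?_
    have := mul_le_mul_of_nonneg_left
      (dist_triangle_right (Θ (f (p.1.2 p.1.1))) (Θ x) (Θ y)) hC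
    simp only [V]
    linarith
  refine ⟨fun y => ⨅ p, V p y, ?_, ?_⟩
  · intro x y
    rw [abs_le]
    have h1 := hlip x y
    have h2 := hlip y x
    rw [dist_comm] at h2
    constructor <;> linarith
  · intro x hx
    rw [← sub_le_iff_le_add]
    refine le_ciInf fun p => ?_
    rw [sub_le_iff_le_add]
    -- Append `x` to the chain. The former final penalty towards `x` becomes an ordinary jump, and
    -- the new final penalty towards `f x` vanishes.
    let q : I := ⟨(p.1.1 + 1, fun i => if i ≤ p.1.1 then p.1.2 i else x), by
      intro i _
      by_cases h : i ≤ p.1.1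
      · simpa [h] using p.2 i h
      · simpa [h] using hx⟩
    refine (ciInf_le (hV (f x)) q).trans_eq ?_
    simp only [V, q]
    rw [Finset.sum_range_succ]
    simp only [le_refl, if_true, Nat.not_succ_le_self, if_false]
    have : ∀ i ∈ Finset.range p.1.1,
        (φ (if i ≤ p.1.1 then p.1.2 i else x) +
          C * dist (Θ (f (if i ≤ p.1.1 then p.1.2 i else x)))
            (Θ (if i + 1 ≤ p.1.1 then p.1.2 (i + 1) else x))) =
        φ (p.1.2 i) + C * dist (Θ (f (p.1.2 i))) (Θ (p.1.2 (i + 1))) := by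
      intro i hi
      have h1 := Finset.mem_range.1 hi
      rw [if_pos h1.le, if_pos (Nat.succ_le_of_lt h1)]
    rw [Finset.sum_congr rfl this, dist_self, mul_zero, add_zero, add_right_comm]
    abel

/-- Chains with small jumps have sums bounded below, provided closed such chains have
non-negative sums. -/
theorem small_chain_sum_lower_bound (Θ : M → Y) (f : M → M) (φ : M → ℝ) {Ω : Set M}
    {C δ b : ℝ} (hC : 0 ≤ C) (hδ : 0 < δ) (hb : 0 ≤ b) (hφ : ∀ x ∈ Ω, -b ≤ φ x)
    (hclosed : ∀ (m : ℕ) (x : ℕ → M), (∀ i ≤ m, x i ∈ Ω) →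
      (∀ i < m, dist (Θ (f (x i))) (Θ (x (i + 1))) < δ) → dist (Θ (f (x m))) (Θ (x 0)) < δ →
      0 ≤ ∑ i ∈ Finset.range m, (φ (x i) + C * dist (Θ (f (x i))) (Θ (x (i + 1)))) +
        (φ (x m) + C * dist (Θ (f (x m))) (Θ (x 0))))
    {κ : Type*} [DecidableEq κ] (cell : M → κ)
    (hcell : ∀ x ∈ Ω, ∀ y ∈ Ω, cell x = cell y → dist (Θ x) (Θ y) < δ / 2) (T : Finset κ) :
    ∀ (m : ℕ) (x : ℕ → M), (∀ i ≤ m, x i ∈ Ω) → (∀ i ≤ m, cell (x i) ∈ T) →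
      (∀ i < m, dist (Θ (f (x i))) (Θ (x (i + 1))) < δ / 2) →
      -(T.card * (b + C * δ)) ≤
        ∑ i ∈ Finset.range m, (φ (x i) + C * dist (Θ (f (x i))) (Θ (x (i + 1)))) + φ (x m) := by
  induction hn : T.card generalizing T with
  | zero =>
    intro m x _ hT
    rw [Finset.card_eq_zero] at hn
    simpa [hn] using hT 0 (Nat.zero_le _)
  | succ n ih =>
    intro m x hx hT hj
    have hCδ : 0 ≤ C * δ := by positivity
    classical
    -- `j` is the last visit to the cell of `x 0`: what precedes `j` is nearly a loop, and what
    -- follows avoids this cell, so that induction on the set of cells applies.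
    obtain ⟨j, ⟨hjm, hjc⟩, hjmax⟩ : ∃ j, (j ≤ m ∧ cell (x j) = cell (x 0)) ∧
        ∀ i, i ≤ m → j < i → cell (x i) ≠ cell (x 0) := by
      let P : ℕ → Prop := fun j => cell (x j) = cell (x 0)
      refine ⟨Nat.findGreatest P m, ⟨Nat.findGreatest_le m,
        Nat.findGreatest_spec (P := P) (Nat.zero_le m) rfl⟩, fun i hi hlt => ?_⟩
      exact Nat.findGreatest_is_greatest hlt hi
    let w : ℕ → ℝ := fun i => φ (x i) + C * dist (Θ (f (x i))) (Θ (x (i + 1)))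
    -- Close the initial segment by jumping to `x 0` instead of `x j`. The two points share a cell,
    -- so the closing jump stays below `δ/2 + δ/2`, and the change of penalty costs at most `C * δ`.
    have hloop : -(C * δ) ≤ ∑ i ∈ Finset.range j, w i := by
      rcases Nat.eq_zero_or_pos j with rfl | hj0
      · simpa using hCδ
      · obtain ⟨k, rfl⟩ : ∃ k, j = k + 1 := ⟨j - 1, by omega⟩
        have hc : dist (Θ (x (k + 1))) (Θ (x 0)) < δ / 2 :=
          hcell _ (hx _ hjm) _ (hx _ (Nat.zero_le _)) hjc
        have htri := dist_triangle (Θ (f (x k))) (Θ (x (k + 1))) (Θ (x 0))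
        have hk := hj k (by omega)
        have := hclosed k x (fun i hi => hx i (by omega))
          (fun i hi => (hj i (by omega)).trans (by linarith)) (by linarith)
        rw [Finset.sum_range_succ]
        simp only [w]
        have h2 := mul_le_mul_of_nonneg_left htri hC
        have h3 : C * dist (Θ (x (k + 1))) (Θ (x 0)) ≤ C * δ :=
          mul_le_mul_of_nonneg_left (by linarith) hC
        linarith
    have hφj := hφ (x j) (hx j hjm)
    rcases hjm.eq_or_lt with rfl | hlt
    · have hn0 : (0 : ℝ) ≤ n * (b + C * δ) := by positivity
      push_cast
      simp only [w] at hloop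
      linarith
    · obtain ⟨k, rfl⟩ : ∃ k, m = j + 1 + k := ⟨m - (j + 1), by omega⟩
      have hmem : cell (x 0) ∈ T := hT 0 (Nat.zero_le _)
      have := ih (T.erase (cell (x 0))) (by rw [Finset.card_erase_of_mem hmem, hn]; rfl)
        k (fun i => x (j + 1 + i)) (fun i hi => hx _ (by omega))
        (fun i hi => Finset.mem_erase.2 ⟨hjmax _ (by omega) (by omega), hT _ (by omega)⟩)
        (fun i hi => hj (j + 1 + i) (by omega))
      have hsum : ∑ i ∈ Finset.range (j + 1 + k), w i =
          ∑ i ∈ Finset.range j, w i + w j + ∑ i ∈ Finset.range k, w (j + 1 + i) := by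
        rw [Finset.sum_range_add, Finset.sum_range_succ]
      have hwj : -b ≤ w j := by
        have : 0 ≤ C * dist (Θ (f (x j))) (Θ (x (j + 1))) := by positivity
        simp only [w]
        linarith
      have hrest : ∑ i ∈ Finset.range k, w (j + 1 + i) = ∑ i ∈ Finset.range k,
          (φ (x (j + 1 + i)) + C * dist (Θ (f (x (j + 1 + i)))) (Θ (x (j + 1 + (i + 1))))) := rfl
      change _ ≤ ∑ i ∈ Finset.range (j + 1 + k), w i + _
      rw [hsum, hrest]
      push_cast
      linarith

/-- If closed chains with small jumps have non-negative sums, then all chain sums are bounded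
below, for a larger jump penalty. -/
theorem exists_chain_sum_lower_bound (Θ : M → Y) (f : M → M) (φ : M → ℝ) {Ω : Set M}
    {C δ b : ℝ} (hC : 0 ≤ C) (hδ : 0 < δ) (hb : 0 ≤ b) (hφ : ∀ x ∈ Ω, -b ≤ φ x)
    (hclosed : ∀ (m : ℕ) (x : ℕ → M), (∀ i ≤ m, x i ∈ Ω) →
      (∀ i < m, dist (Θ (f (x i))) (Θ (x (i + 1))) < δ) → dist (Θ (f (x m))) (Θ (x 0)) < δ →
      0 ≤ ∑ i ∈ Finset.range m, (φ (x i) + C * dist (Θ (f (x i))) (Θ (x (i + 1)))) +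
        (φ (x m) + C * dist (Θ (f (x m))) (Θ (x 0))))
    {κ : Type*} (cell : M → κ) (T : Finset κ) (hT : ∀ x ∈ Ω, cell x ∈ T)
    (hcell : ∀ x ∈ Ω, ∀ y ∈ Ω, cell x = cell y → dist (Θ x) (Θ y) < δ / 2) :
    ∃ C' B : ℝ, 0 ≤ C' ∧ ∀ (m : ℕ) (x : ℕ → M), (∀ i ≤ m, x i ∈ Ω) →
      -B ≤ ∑ i ∈ Finset.range m, (φ (x i) + C' * dist (Θ (f (x i))) (Θ (x (i + 1)))) +
        φ (x m) := by
  classical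
  set B : ℝ := T.card * (b + C * δ) with hBdef
  have hB : 0 ≤ B := by positivity
  -- With the extra `2 * B / δ`, a jump of size at least `δ/2` is worth at least `B`.
  refine ⟨C + 2 * B / δ, B, by positivity, ?_⟩
  have hCC : C ≤ C + 2 * B / δ := by
    have : 0 ≤ 2 * B / δ := by positivity
    linarith
  intro m
  induction m using Nat.strong_induction_on with
  | _ m ih =>
    intro x hx
    by_cases hgood : ∀ i < m, dist (Θ (f (x i))) (Θ (x (i + 1))) < δ / 2
    · refine (small_chain_sum_lower_bound Θ f φ hC hδ hb hφ hclosed cell hcell T m x hx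
        (fun i hi => hT _ (hx i hi)) hgood).trans ?_
      gcongr
    · push Not at hgood
      -- Cut at a large jump: both pieces are at least `-B` by induction, and the jump pays for one
      -- of them.
      obtain ⟨j, hjm, hj⟩ := hgood
      obtain ⟨k, rfl⟩ : ∃ k, m = j + 1 + k := ⟨m - (j + 1), by omega⟩
      have h1 := ih j (by omega) x (fun i hi => hx i (by omega))
      have h2 := ih k (by omega) (fun i => x (j + 1 + i)) (fun i hi => hx _ (by omega))
      rw [Finset.sum_range_add, Finset.sum_range_succ]
      have h3 : B ≤ (C + 2 * B / δ) * dist (Θ (f (x j))) (Θ (x (j + 1))) := by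
        calc B = 2 * B / δ * (δ / 2) := by field_simp
          _ ≤ (C + 2 * B / δ) * dist (Θ (f (x j))) (Θ (x (j + 1))) := by
            gcongr
            linarith
      have h4 : ∑ i ∈ Finset.range k, (φ (x (j + 1 + i)) + (C + 2 * B / δ) *
          dist (Θ (f (x (j + 1 + i)))) (Θ (x (j + 1 + i + 1)))) = ∑ i ∈ Finset.range k,
          (φ (x (j + 1 + i)) + (C + 2 * B / δ) *
          dist (Θ (f (x (j + 1 + i)))) (Θ (x (j + 1 + (i + 1))))) := rfl
      rw [h4]
      linarith

end Chains

/-! ### Comparison of the Finsler distance with charts -/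

section Finsler

variable {d : ℕ} {M : Type*} [TopologicalSpace M]
  [ChartedSpace (EuclideanSpace ℝ (Fin d)) M] [IsManifold (𝓡 d) 1 M]

/-- Two absolutely homogeneous functions on the tangent bundle, the second one being positive, are
comparable over a compact subset of a chart domain. -/
theorem exists_le_mul_of_isCompact (c : M) {K : Set M} (hK : IsCompact K)
    (hKc : K ⊆ (chartAt (EuclideanSpace ℝ (Fin d)) c).source)
    (n₁ n₂ : ∀ x : M, TangentSpace (𝓡 d) x → ℝ)
    (h₁ : ContinuousOn (fun p : TangentBundle (𝓡 d) M => n₁ p.1 p.2)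
      {p | p.1 ∈ (chartAt (EuclideanSpace ℝ (Fin d)) c).source})
    (h₂ : ContinuousOn (fun p : TangentBundle (𝓡 d) M => n₂ p.1 p.2)
      {p | p.1 ∈ (chartAt (EuclideanSpace ℝ (Fin d)) c).source})
    (hom₁ : ∀ x ∈ K, ∀ (a : ℝ) v, n₁ x (a • v) = |a| * n₁ x v)
    (hom₂ : ∀ x ∈ K, ∀ (a : ℝ) v, n₂ x (a • v) = |a| * n₂ x v)
    (pos₂ : ∀ x ∈ K, ∀ v, v ≠ 0 → 0 < n₂ x v) :
    ∃ A : ℝ, 0 < A ∧ ∀ x ∈ K, ∀ v, n₁ x v ≤ A * n₂ x v := by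
  set T := trivializationAt (EuclideanSpace ℝ (Fin d)) (TangentSpace (𝓡 d) (M := M)) c with hT
  have hbase : T.baseSet = (chartAt (EuclideanSpace ℝ (Fin d)) c).source := rfl
  have hTc : ContinuousOn (fun p : M × EuclideanSpace ℝ (Fin d) =>
      (⟨p.1, T.symm p.1 p.2⟩ : TangentBundle (𝓡 d) M)) (K ×ˢ Metric.sphere 0 1) := by
    refine (T.continuousOn_symm).mono ?_
    exact Set.prod_mono (hKc.trans hbase.ge) (subset_univ _)
  have hmaps : MapsTo (fun p : M × EuclideanSpace ℝ (Fin d) =>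
      (⟨p.1, T.symm p.1 p.2⟩ : TangentBundle (𝓡 d) M)) (K ×ˢ Metric.sphere 0 1)
      {p | p.1 ∈ (chartAt (EuclideanSpace ℝ (Fin d)) c).source} := fun p hp => hKc hp.1
  have hsymm : ∀ x ∈ K, ∀ v : TangentSpace (𝓡 d) x,
      T.symm x (T.continuousLinearMapAt ℝ x v) = v := fun x hx v => by
    rw [← T.coe_symmₗ (R := ℝ) (hKc hx)]
    exact T.symmₗ_linearMapAt (hbase ▸ hKc hx) v
  have hsymm0 : ∀ x ∈ K, ∀ w, w ≠ 0 → T.symm x w ≠ 0 := fun x hx w hw h => by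
    apply hw
    have := T.linearMapAt_symmₗ (R := ℝ) (hbase ▸ hKc hx) w
    rw [T.coe_symmₗ (R := ℝ) (hKc hx), h, map_zero] at this
    exact this.symm
  -- By homogeneity it suffices to bound the quotient on unit vectors of the trivialization, which
  -- form a compact set over `K`.
  have hcont : ContinuousOn (fun p : M × EuclideanSpace ℝ (Fin d) =>
      n₁ p.1 (T.symm p.1 p.2) / n₂ p.1 (T.symm p.1 p.2)) (K ×ˢ Metric.sphere 0 1) := by
    refine (h₁.comp hTc hmaps).div (h₂.comp hTc hmaps) ?_
    rintro ⟨x, w⟩ ⟨hx, hw⟩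
    refine (pos₂ x hx _ (hsymm0 x hx w ?_)).ne'
    exact ne_zero_of_mem_unit_sphere ⟨w, hw⟩
  obtain ⟨A, hA⟩ := ((hK.prod (isCompact_sphere _ _)).image_of_continuousOn hcont).bddAbove
  refine ⟨max A 1, by positivity, fun x hx v => ?_⟩
  by_cases hv : v = 0
  · have e1 := hom₁ x hx 0 0
    have e2 := hom₂ x hx 0 0
    simp only [zero_smul, abs_zero, zero_mul] at e1 e2
    rw [hv, e1, e2, mul_zero]
  set w := T.continuousLinearMapAt ℝ x v with hw
  have hw0 : w ≠ 0 := by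
    intro h
    have := hsymm x hx v
    rw [← hw, h, ← T.coe_symmₗ (R := ℝ) (hKc hx), map_zero] at this
    exact hv this.symm
  have hmem : ((x, ‖w‖⁻¹ • w) : M × EuclideanSpace ℝ (Fin d)) ∈ K ×ˢ Metric.sphere 0 1 := by
    refine ⟨hx, ?_⟩
    simp [norm_smul, hw0]
  have h3 := hA (mem_image_of_mem _ hmem)
  have hs : T.symm x (‖w‖⁻¹ • w) = ‖w‖⁻¹ • v := by
    have := hsymm x hx v
    rw [← T.coe_symmₗ (R := ℝ) (hKc hx)] at this ⊢
    rw [map_smul, this]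
  have hpos := pos₂ x hx v hv
  have hwn : (0 : ℝ) < |‖w‖⁻¹| := by positivity
  simp only [hs, hom₁ x hx, hom₂ x hx] at h3
  rw [mul_div_mul_left _ _ hwn.ne', div_le_iff₀ hpos] at h3
  exact h3.trans (mul_le_mul_of_nonneg_right (le_max_left _ _) hpos.le)

/-- The derivative of a chart is continuous on the tangent bundle over the chart domain. -/
theorem continuousOn_mfderiv_extChartAt (c : M) :
    ContinuousOn (fun p : TangentBundle (𝓡 d) M =>
      (mfderiv (𝓡 d) 𝓘(ℝ, EuclideanSpace ℝ (Fin d)) (extChartAt (𝓡 d) c) p.1 p.2 :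
        EuclideanSpace ℝ (Fin d)))
      {p | p.1 ∈ (chartAt (EuclideanSpace ℝ (Fin d)) c).source} := by
  set T := trivializationAt (EuclideanSpace ℝ (Fin d)) (TangentSpace (𝓡 d) (M := M)) c
  have hsource : T.source =
      {p | p.1 ∈ (chartAt (EuclideanSpace ℝ (Fin d)) c).source} := T.source_eq
  rw [← hsource]
  refine (continuous_snd.comp_continuousOn T.continuousOn).congr fun p hp => ?_
  rw [hsource] at hp
  rw [← TangentBundle.continuousLinearMapAt_trivializationAt hp]
  change T.linearMapAt ℝ p.1 p.2 = _
  rw [T.coe_linearMapAt_of_mem (R := ℝ) hp]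
  rfl

theorem mfderiv_extChartAt_injective {c x : M}
    (hx : x ∈ (chartAt (EuclideanSpace ℝ (Fin d)) c).source) :
    Function.Injective
      (mfderiv (𝓡 d) 𝓘(ℝ, EuclideanSpace ℝ (Fin d)) (extChartAt (𝓡 d) c) x) :=
  (isInvertible_mfderiv_extChartAt (by rwa [extChartAt_source])).injective


omit [IsManifold (𝓡 d) 1 M] in
theorem norm_mfderiv_smul {Z : Type*} [NormedAddCommGroup Z] [NormedSpace ℝ Z] (θ : M → Z) (x : M)
    (a : ℝ) (v : TangentSpace (𝓡 d) x) :
    Norm.norm (E := Z) (mfderiv (𝓡 d) 𝓘(ℝ, Z) θ x (a • v)) =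
      |a| * Norm.norm (E := Z) (mfderiv (𝓡 d) 𝓘(ℝ, Z) θ x v) := by
  have key : ∀ (T : EuclideanSpace ℝ (Fin d) →L[ℝ] Z) (w : EuclideanSpace ℝ (Fin d)),
      ‖T (a • w)‖ = |a| * ‖T w‖ := fun T w => by
    rw [map_smul, norm_smul, Real.norm_eq_abs]
  exact key (mfderiv (𝓡 d) 𝓘(ℝ, Z) θ x) v

namespace FinslerNorm

variable (F : FinslerNorm d M)

theorem norm_smul_eq (x : M) (a : ℝ) (v : TangentSpace (𝓡 d) x) :
    F.norm x (a • v) = |a| * F.norm x v := by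
  rw [map_smul_eq_mul, Real.norm_eq_abs]

/-- The Finsler distance is locally bounded by the distance in a chart. -/
theorem exists_finslerEDist_le_edist_extChartAt {c y : M}
    (hy : y ∈ (chartAt (EuclideanSpace ℝ (Fin d)) c).source) :
    ∃ A : ℝ≥0, ∃ W ∈ 𝓝 y, ∀ x ∈ W, ∀ x' ∈ W,
      F.finslerEDist x x' ≤ A * edist (extChartAt (𝓡 d) c x) (extChartAt (𝓡 d) c x') := by
  have : LocallyCompactSpace M := ChartedSpace.locallyCompactSpace (EuclideanSpace ℝ (Fin d)) M
  obtain ⟨K, hKy, hKc, hK⟩ := local_compact_nhds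
    ((chartAt (EuclideanSpace ℝ (Fin d)) c).open_source.mem_nhds hy)
  obtain ⟨A, hA0, hA⟩ := exists_le_mul_of_isCompact c hK hKc (fun x v => F.norm x v)
    (fun x v => Norm.norm (E := EuclideanSpace ℝ (Fin d))
      (mfderiv (𝓡 d) 𝓘(ℝ, EuclideanSpace ℝ (Fin d)) (extChartAt (𝓡 d) c) x v)) F.continuous.continuousOn
    (continuousOn_mfderiv_extChartAt c).norm (fun x _ a v => F.norm_smul_eq x a v)
    (fun x _ a v => norm_mfderiv_smul _ x a v)
    (fun x hx v hv => by
      refine (norm_pos_iff (E := EuclideanSpace ℝ (Fin d))).2 fun h => ?_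
      exact hv (mfderiv_extChartAt_injective (hKc hx) (h.trans (map_zero _).symm)))
  set e := extChartAt (𝓡 d) c with he
  have hye : y ∈ e.source := by rwa [he, extChartAt_source]
  have hey : e y ∈ e.target := e.map_source hye
  obtain ⟨r, hr, hball⟩ : ∃ r > 0, Metric.ball (e y) r ⊆ e.target ∩ e.symm ⁻¹' K := by
    refine Metric.mem_nhds_iff.1 (Filter.inter_mem ?_ ?_)
    · exact (isOpen_extChartAt_target c).mem_nhds hey
    · have : ContinuousAt e.symm (e y) := continuousAt_extChartAt_symm'' hey
      refine this.preimage_mem_nhds ?_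
      rwa [e.left_inv hye]
  refine ⟨A.toNNReal, e.source ∩ e ⁻¹' Metric.ball (e y) r, ?_, ?_⟩
  · refine Filter.inter_mem ((isOpen_extChartAt_source c).mem_nhds hye) ?_
    exact (continuousAt_extChartAt' hye).preimage_mem_nhds (Metric.ball_mem_nhds _ hr)
  rintro x ⟨hxs, hx⟩ x' ⟨hxs', hx'⟩
  unfold finslerEDist
  let _ : ∀ z : M, ENorm (TangentSpace (𝓡 d) z) := fun z => ⟨fun v => ENNReal.ofReal (F.norm z v)⟩
  let _ : ∀ z : M, ENormSMulClass ℝ (TangentSpace (𝓡 d) z) := fun z => ⟨fun a v => by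
    change ENNReal.ofReal (F.norm z (a • v)) = ‖a‖ₑ * ENNReal.ofReal (F.norm z v)
    rw [F.norm_smul_eq, ENNReal.ofReal_mul (abs_nonneg _), ← Real.enorm_eq_ofReal_abs]⟩
  -- The competitor is the straight segment in the chart; it stays in a ball whose preimage lies in
  -- the compact set where the norms compare.
  let η := ContinuousAffineMap.lineMap (R := ℝ) (e x) (e x')
  have hη : Icc (0 : ℝ) 1 ⊆ η ⁻¹' Metric.ball (e y) r := by
    simp only [← image_subset_iff, ContinuousAffineMap.coe_lineMap_eq,
      ← segment_eq_image_lineMap, η]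
    exact (convex_ball _ _).segment_subset hx hx'
  have hηs : ContMDiffOn 𝓘(ℝ, ℝ) 𝓘(ℝ, EuclideanSpace ℝ (Fin d)) 1 η (Icc 0 1) := by
    apply ContMDiff.contMDiffOn
    rw [contMDiff_iff_contDiff]
    exact ContinuousAffineMap.contDiff _
  have hγs : ContMDiffOn 𝓘(ℝ, ℝ) (𝓡 d) 1 (e.symm ∘ η) (Icc 0 1) :=
    (contMDiffOn_extChartAt_symm c).comp hηs fun t ht => (hball (hη ht)).1
  refine (Manifold.riemannianEDist_le_pathELength (γ := e.symm ∘ η) (a := 0) (b := 1) hγs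
    ?_ ?_ zero_le_one).trans ?_
  · simp [η, ContinuousAffineMap.coe_lineMap_eq, e.left_inv hxs]
  · simp [η, ContinuousAffineMap.coe_lineMap_eq, e.left_inv hxs']
  rw [Manifold.pathELength_eq_lintegral_mfderiv_Ioo]
  calc _ ≤ ∫⁻ _ in Ioo (0 : ℝ) 1, (A.toNNReal : ℝ≥0∞) * edist (e x) (e x') := by
        refine MeasureTheory.setLIntegral_mono' measurableSet_Ioo fun t ht => ?_
        have ht' : t ∈ Icc (0 : ℝ) 1 := Ioo_subset_Icc_self ht
        have hnt : Icc (0 : ℝ) 1 ∈ 𝓝 t := Icc_mem_nhds ht.1 ht.2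
        have hγK : (e.symm ∘ η) t ∈ K := (hball (hη ht')).2
        have hγd : MDifferentiableAt 𝓘(ℝ, ℝ) (𝓡 d) (e.symm ∘ η) t :=
          ((hγs t ht').contMDiffAt hnt).mdifferentiableAt one_ne_zero
        have hed : MDifferentiableAt (𝓡 d) 𝓘(ℝ, EuclideanSpace ℝ (Fin d)) e ((e.symm ∘ η) t) :=
          mdifferentiableAt_extChartAt (hKc hγK)
        have hcomp := mfderiv_comp t hed hγd
        have heq : e ∘ (e.symm ∘ η) =ᶠ[𝓝 t] η := by
          filter_upwards [hnt] with s hs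
          exact e.right_inv (hball (hη hs)).1
        rw [heq.mfderiv_eq, mfderiv_eq_fderiv] at hcomp
        have hder : fderiv ℝ η t 1 = e x' - e x := by simp [η]
        have h1 := hA _ hγK (mfderiv 𝓘(ℝ, ℝ) (𝓡 d) (e.symm ∘ η) t 1)
        have h2 : mfderiv (𝓡 d) 𝓘(ℝ, EuclideanSpace ℝ (Fin d)) e ((e.symm ∘ η) t)
            (mfderiv 𝓘(ℝ, ℝ) (𝓡 d) (e.symm ∘ η) t 1) = e x' - e x := by
          rw [← hder, hcomp]
          rfl
        rw [h2] at h1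
        change ENNReal.ofReal (F.norm _ _) ≤ _
        refine (ENNReal.ofReal_le_ofReal h1).trans_eq ?_
        rw [ENNReal.ofReal_mul hA0.le, edist_comm, edist_dist, dist_eq_norm]
        rfl
    _ = _ := by simp

/-- A `C¹` map to a normed space with bounded derivative is Lipschitz for the Finsler distance. -/
theorem edist_le_mul_finslerEDist {Z : Type*} [NormedAddCommGroup Z] [NormedSpace ℝ Z]
    {θ : M → Z} (hθ : ContMDiff (𝓡 d) 𝓘(ℝ, Z) 1 θ) {A : ℝ≥0} (hA0 : 0 < A)
    (hA : ∀ x (v : TangentSpace (𝓡 d) x),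
      Norm.norm (E := Z) (mfderiv (𝓡 d) 𝓘(ℝ, Z) θ x v) ≤ A * F.norm x v) (x y : M) :
    edist (θ x) (θ y) ≤ A * F.finslerEDist x y := by
  unfold finslerEDist
  let _ : ∀ z : M, ENorm (TangentSpace (𝓡 d) z) := fun z => ⟨fun v => ENNReal.ofReal (F.norm z v)⟩
  let _ : ∀ z : M, ENormSMulClass ℝ (TangentSpace (𝓡 d) z) := fun z => ⟨fun a v => by
    change ENNReal.ofReal (F.norm z (a • v)) = ‖a‖ₑ * ENNReal.ofReal (F.norm z v)
    rw [F.norm_smul_eq, ENNReal.ofReal_mul (abs_nonneg _), ← Real.enorm_eq_ofReal_abs]⟩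
  change _ ≤ _ * Manifold.riemannianEDist (𝓡 d) x y
  -- The infimum of lengths need not be attained, so the bound is proved for every larger length.
  -- The positivity of `A` excludes the product of 0 and infinity.
  refine ENNReal.le_mul_of_forall_lt (Or.inl (by simpa using hA0.ne'))
    (Or.inl ENNReal.coe_ne_top) fun A' hA' r hr => ?_
  obtain ⟨γ, rfl, rfl, hγ, hlen⟩ := Manifold.exists_lt_of_riemannianEDist_lt hr
  have hcd : ContDiffOn ℝ 1 (θ ∘ γ) (Icc 0 1) :=
    contMDiffOn_iff_contDiffOn.1 (hθ.comp_contMDiffOn hγ)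
  have h1 := enorm_sub_le_lintegral_deriv_of_contDiffOn_Icc hcd zero_le_one
  rw [Manifold.pathELength_eq_lintegral_mfderiv_Ioo] at hlen
  rw [← MeasureTheory.restrict_Ioo_eq_restrict_Icc] at h1
  rw [edist_comm, edist_eq_enorm_sub]
  refine h1.trans (le_trans ?_ (mul_le_mul' hA'.le hlen.le))
  rw [← MeasureTheory.lintegral_const_mul' _ _ ENNReal.coe_ne_top]
  refine MeasureTheory.setLIntegral_mono' measurableSet_Ioo fun t ht => ?_
  have hnt : Icc (0 : ℝ) 1 ∈ 𝓝 t := Icc_mem_nhds ht.1 ht.2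
  have hγd : MDifferentiableAt 𝓘(ℝ, ℝ) (𝓡 d) γ t :=
    ((hγ t (Ioo_subset_Icc_self ht)).contMDiffAt hnt).mdifferentiableAt one_ne_zero
  have hcomp := mfderiv_comp t ((hθ (γ t)).mdifferentiableAt one_ne_zero) hγd
  have h2 : deriv (θ ∘ γ) t =
      mfderiv (𝓡 d) 𝓘(ℝ, Z) θ (γ t) (mfderiv 𝓘(ℝ, ℝ) (𝓡 d) γ t 1) := by
    rw [← fderiv_apply_one_eq_deriv, ← mfderiv_eq_fderiv, hcomp]
    rfl
  have h3 := hA (γ t) (mfderiv 𝓘(ℝ, ℝ) (𝓡 d) γ t 1)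
  rw [← ofReal_norm, h2]
  refine (ENNReal.ofReal_le_ofReal h3).trans_eq ?_
  rw [ENNReal.ofReal_mul A.coe_nonneg, ENNReal.ofReal_coe_nnreal]
  rfl

end FinslerNorm

end Finsler

/-! ### A Lipschitz map to a normed space that separates points near `Λ` -/

section Separation

variable {d : ℕ} {M : Type*} [TopologicalSpace M] [T2Space M]
  [ChartedSpace (EuclideanSpace ℝ (Fin d)) M] [IsManifold (𝓡 d) 1 M]

omit [T2Space M] in
theorem continuous_norm_mfderiv {Z : Type*} [NormedAddCommGroup Z] [NormedSpace ℝ Z]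
    {θ : M → Z} (hθ : ContMDiff (𝓡 d) 𝓘(ℝ, Z) 1 θ) :
    Continuous fun p : TangentBundle (𝓡 d) M =>
      Norm.norm (E := Z) (mfderiv (𝓡 d) 𝓘(ℝ, Z) θ p.1 p.2) := by
  have h1 := hθ.continuous_tangentMap le_rfl
  have h2 := (tangentBundleModelSpaceHomeomorph 𝓘(ℝ, Z)).continuous.comp h1
  exact (continuous_snd.comp h2).norm

/-- A `C¹` map, Lipschitz for the Finsler distance, which recovers a chart near its centre. -/
theorem exists_lipschitz_chart_extension (F : FinslerNorm d M) (c : M) {O : Set M}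
    (hO : O ∈ 𝓝 c) :
    ∃ (θ : M → ℝ × EuclideanSpace ℝ (Fin d)) (V : Set M) (A : ℝ≥0) (R K : ℝ),
      IsCompact V ∧ V ∈ 𝓝 c ∧ V ⊆ O ∧ V ⊆ (extChartAt (𝓡 d) c).source ∧
      ContMDiff (𝓡 d) 𝓘(ℝ, ℝ × EuclideanSpace ℝ (Fin d)) 1 θ ∧
      (∀ x y, edist (θ x) (θ y) ≤ A * F.finslerEDist x y) ∧ (∀ x y, dist (θ x) (θ y) ≤ R) ∧
      ∀ x ∈ V, ∀ y, dist (θ x) (θ y) < 1 / 2 → y ∈ (extChartAt (𝓡 d) c).source ∧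
        dist (extChartAt (𝓡 d) c x) (extChartAt (𝓡 d) c y) ≤ K * dist (θ x) (θ y) := by
  classical
  set e := extChartAt (𝓡 d) c with he
  have hcs : c ∈ e.source := mem_extChartAt_source c
  have hct : e c ∈ e.target := mem_extChartAt_target c
  obtain ⟨R₀, hR₀, hball⟩ : ∃ r > 0, Metric.closedBall (e c) r ⊆ e.target :=
    Metric.nhds_basis_closedBall.mem_iff.1 ((isOpen_extChartAt_target c).mem_nhds hct)
  obtain ⟨r₁, hr₁, hball₁⟩ : ∃ r > 0, Metric.closedBall (e c) r ⊆ e.symm ⁻¹' O := by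
    refine Metric.nhds_basis_closedBall.mem_iff.1 ?_
    refine (continuousAt_extChartAt_symm c).preimage_mem_nhds ?_
    simpa using hO
  let b : ContDiffBump (e c) := ⟨R₀ / 2, R₀, by positivity, by linarith⟩
  -- The chart is cut off by the bump `b`, and `b` itself is kept as an extra coordinate. It tells
  -- whether a point lies in the chart domain, which the product `b z • z` alone cannot do.
  let h : EuclideanSpace ℝ (Fin d) → ℝ × EuclideanSpace ℝ (Fin d) := fun z => (b z, b z • z)
  have hh : ContDiff ℝ 1 h := b.contDiff.prodMk (b.contDiff.smul contDiff_id)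
  let θ : M → ℝ × EuclideanSpace ℝ (Fin d) := fun x => if x ∈ e.source then h (e x) else 0
  have hbsupp : ∀ z, z ∉ Metric.closedBall (e c) R₀ → b z = 0 := fun z hz => by
    apply b.zero_of_le_dist
    simp only [Metric.mem_closedBall, not_le] at hz
    exact hz.le
  let K : Set M := e.symm '' Metric.closedBall (e c) R₀
  have hKcomp : IsCompact K := (isCompact_closedBall _ _).image_of_continuousOn
    ((continuousOn_extChartAt_symm c).mono hball)
  have hKs : K ⊆ e.source := by
    rintro _ ⟨z, hz, rfl⟩
    exact e.map_target (hball hz)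
  have hθK : ∀ x, x ∉ K → θ x = 0 := by
    intro x hx
    by_cases hxs : x ∈ e.source
    · have : e x ∉ Metric.closedBall (e c) R₀ := fun hm => hx ⟨e x, hm, e.left_inv hxs⟩
      simp [θ, hxs, h, hbsupp _ this]
    · simp [θ, hxs]
  have hθs : ∀ x ∈ e.source, θ =ᶠ[𝓝 x] h ∘ e := by
    intro x hx
    filter_upwards [(isOpen_extChartAt_source c).mem_nhds hx] with y hy
    simp only [θ, Function.comp]
    rw [if_pos hy]
  have hθz : ∀ x, x ∉ K → θ =ᶠ[𝓝 x] fun _ => 0 := by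
    intro x hx
    filter_upwards [hKcomp.isClosed.isOpen_compl.mem_nhds hx] with y hy using hθK y hy
  have hθ : ContMDiff (𝓡 d) 𝓘(ℝ, ℝ × EuclideanSpace ℝ (Fin d)) 1 θ := by
    intro x
    by_cases hx : x ∈ K
    · refine ContMDiffAt.congr_of_eventuallyEq ?_ (hθs x (hKs hx))
      refine hh.contDiffAt.contMDiffAt.comp x ?_
      exact contMDiffAt_extChartAt' (by
        have := hKs hx
        rwa [he, extChartAt_source] at this)
    · exact contMDiffAt_const.congr_of_eventuallyEq (hθz x hx)
  obtain ⟨A, hA0, hA⟩ := exists_le_mul_of_isCompact c hKcomp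
    (by rwa [← extChartAt_source (𝓡 d)])
    (fun x v => Norm.norm (E := ℝ × EuclideanSpace ℝ (Fin d))
      (mfderiv (𝓡 d) 𝓘(ℝ, ℝ × EuclideanSpace ℝ (Fin d)) θ x v)) (fun x v => F.norm x v)
    (continuous_norm_mfderiv hθ).continuousOn F.continuous.continuousOn
    (fun x _ a v => norm_mfderiv_smul θ x a v)
    (fun x _ a v => F.norm_smul_eq x a v) (fun x _ v hv => F.pos x v hv)
  have hhb : ∃ R, ∀ z, ‖h z‖ ≤ R := by
    obtain ⟨R, hR⟩ := (isCompact_closedBall (e c) R₀).exists_bound_of_continuousOn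
      hh.continuous.continuousOn
    refine ⟨max R 0, fun z => ?_⟩
    by_cases hz : z ∈ Metric.closedBall (e c) R₀
    · exact (hR z hz).trans (le_max_left _ _)
    · simp [h, hbsupp z hz]
  obtain ⟨R, hR⟩ := hhb
  have hRθ : ∀ x, ‖θ x‖ ≤ R := by
    intro x
    by_cases hx : x ∈ e.source
    · simp only [θ, hx, if_true]
      exact hR _
    · simp only [θ, hx, if_false, norm_zero]
      exact (norm_nonneg _).trans (hR 0)
  let r := min (R₀ / 2) r₁
  have hrR : r ≤ R₀ := (min_le_left _ _).trans (by linarith)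
  refine ⟨θ, e.symm '' Metric.closedBall (e c) r, A.toNNReal, R + R, 1 + (‖e c‖ + R₀), ?_, ?_,
    ?_, ?_, hθ, ?_, ?_, ?_⟩
  · exact (isCompact_closedBall _ _).image_of_continuousOn
      ((continuousOn_extChartAt_symm c).mono
        ((Metric.closedBall_subset_closedBall hrR).trans hball))
  · have h1 : e.source ∩ e ⁻¹' Metric.closedBall (e c) r ∈ 𝓝 c := by
      refine Filter.inter_mem ((isOpen_extChartAt_source c).mem_nhds hcs) ?_
      exact (continuousAt_extChartAt c).preimage_mem_nhds
        (Metric.closedBall_mem_nhds _ (lt_min (by positivity) hr₁))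
    refine Filter.mem_of_superset h1 ?_
    rintro x ⟨hx, hx'⟩
    exact ⟨e x, hx', e.left_inv hx⟩
  · rintro _ ⟨z, hz, rfl⟩
    exact hball₁ (Metric.closedBall_subset_closedBall (min_le_right _ _) hz)
  · rintro _ ⟨z, hz, rfl⟩
    exact e.map_target (hball (Metric.closedBall_subset_closedBall hrR hz))
  · refine F.edist_le_mul_finslerEDist hθ (by simpa using hA0) fun x v => ?_
    rw [Real.coe_toNNReal _ hA0.le]
    by_cases hx : x ∈ K
    · exact hA x hx v
    · rw [(hθz x hx).mfderiv_eq, mfderiv_const]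
      change ‖(0 : ℝ × EuclideanSpace ℝ (Fin d))‖ ≤ _
      rw [norm_zero]
      exact mul_nonneg hA0.le (apply_nonneg _ _)
  · intro x y
    rw [dist_eq_norm]
    exact (norm_sub_le _ _).trans (add_le_add (hRθ x) (hRθ y))
  · rintro _ ⟨z, hz, rfl⟩ y hxy
    have hzt : z ∈ e.target := hball (Metric.closedBall_subset_closedBall hrR hz)
    have hθx : θ (e.symm z) = (1, z) := by
      have hb1 : b z = 1 := b.one_of_mem_closedBall
        (Metric.closedBall_subset_closedBall (min_le_left _ _) hz)
      simp only [θ]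
      rw [if_pos (e.map_target hzt), e.right_inv hzt]
      simp [h, hb1]
    rw [hθx] at hxy ⊢
    -- Outside the chart domain the first coordinate is 0, at distance 1 from its value at points of
    -- `V`; the threshold `1/2` excludes this.
    have hys : y ∈ e.source := by
      by_contra hys
      simp only [θ, hys, if_false] at hxy
      have : dist (1 : ℝ) 0 ≤ dist ((1, z) : ℝ × EuclideanSpace ℝ (Fin d)) 0 := by
        rw [Prod.dist_eq]
        exact le_max_left _ _
      rw [Real.dist_eq] at this
      norm_num at this hxy
    refine ⟨hys, ?_⟩
    have hθy : θ y = (b (e y), b (e y) • e y) := by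
      simp only [θ]
      rw [if_pos hys]
    rw [hθy] at hxy ⊢
    set ρ := dist ((1, z) : ℝ × EuclideanSpace ℝ (Fin d)) (b (e y), b (e y) • e y) with hρ
    have h1 : |1 - b (e y)| ≤ ρ := by
      rw [hρ, Prod.dist_eq, ← Real.dist_eq]
      exact le_max_left _ _
    have h2 : dist z (b (e y) • e y) ≤ ρ := by
      rw [hρ, Prod.dist_eq]
      exact le_max_right _ _
    have hb0 : b (e y) ≠ 0 := by
      intro h0
      rw [h0] at h1
      norm_num at h1
      linarith
    have hyb : e y ∈ Metric.closedBall (e c) R₀ := by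
      by_contra hcon
      exact hb0 (hbsupp _ hcon)
    have hyn : ‖e y‖ ≤ ‖e c‖ + R₀ := by
      have h3 := Metric.mem_closedBall.1 hyb
      rw [dist_eq_norm] at h3
      have := norm_add_le (e c) (e y - e c)
      rw [add_sub_cancel] at this
      linarith
    have h4 : dist (b (e y) • e y) (e y) ≤ ρ * (‖e c‖ + R₀) := by
      rw [dist_comm, dist_eq_norm]
      have : e y - b (e y) • e y = (1 - b (e y)) • e y := by rw [sub_smul, one_smul]
      rw [this, norm_smul, Real.norm_eq_abs]
      exact mul_le_mul h1 hyn (norm_nonneg _) ((abs_nonneg _).trans h1)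
    rw [e.right_inv hzt]
    calc dist z (e y) ≤ dist z (b (e y) • e y) + dist (b (e y) • e y) (e y) :=
          dist_triangle _ _ _
      _ ≤ ρ + ρ * (‖e c‖ + R₀) := add_le_add h2 h4
      _ = _ := by ring

/-- A finite family of charts covering the set `Λ`, together with a bounded `C¹` map `Θ`, Lipschitz
for the Finsler distance, which separates points as the charts do. -/
structure ChartCover (F : FinslerNorm d M) (Λ : Set M) where
  /-- The centres of the charts. -/
  S : Finset M
  /-- Compact subsets of the chart domains covering `Λ`. -/
  V : M → Set M
  /-- The separating map. -/
  Θ : M → S → ℝ × EuclideanSpace ℝ (Fin d)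
  /-- A Lipschitz constant of `Θ`. -/
  A : ℝ≥0
  /-- A bound for the diameter of the image of `Θ`. -/
  R : ℝ
  /-- A Lipschitz constant of the charts in terms of `Θ`. -/
  K : ℝ
  isCompact_V : ∀ c ∈ S, IsCompact (V c)
  V_subset : ∀ c ∈ S, V c ⊆ (extChartAt (𝓡 d) c).source
  exists_mem_nhds : ∀ x ∈ Λ, ∃ c ∈ S, V c ∈ 𝓝 x
  contMDiff : ContMDiff (𝓡 d) 𝓘(ℝ, S → ℝ × EuclideanSpace ℝ (Fin d)) 1 Θ
  edist_le : ∀ x y, edist (Θ x) (Θ y) ≤ A * F.finslerEDist x y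
  R_nonneg : 0 ≤ R
  dist_le : ∀ x y, dist (Θ x) (Θ y) ≤ R
  K_nonneg : 0 ≤ K
  mem_source : ∀ c ∈ S, ∀ x ∈ V c, ∀ y, dist (Θ x) (Θ y) < 1 / 2 →
    y ∈ (extChartAt (𝓡 d) c).source
  dist_extChartAt_le : ∀ c ∈ S, ∀ x ∈ V c, ∀ y, dist (Θ x) (Θ y) < 1 / 2 →
    dist (extChartAt (𝓡 d) c x) (extChartAt (𝓡 d) c y) ≤ K * dist (Θ x) (Θ y)

/-- Compactness gives finitely many centres, and the cut-off charts are collected into one map with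
the sup distance; the constants are sums over the centres. The prescribed sets `O c` later ensure
that each piece supports a frame of the splitting. -/
theorem exists_chartCover (F : FinslerNorm d M) {Λ : Set M} (hΛ : IsCompact Λ)
    (O : M → Set M) (hO : ∀ c ∈ Λ, O c ∈ 𝓝 c) :
    ∃ cov : ChartCover F Λ, ∀ c ∈ cov.S, c ∈ Λ ∧ cov.V c ⊆ O c := by
  have key : ∀ c : M, ∃ (θ : M → ℝ × EuclideanSpace ℝ (Fin d)) (V : Set M) (A : ℝ≥0) (R K : ℝ),
      c ∈ Λ → (IsCompact V ∧ V ∈ 𝓝 c ∧ V ⊆ O c ∧ V ⊆ (extChartAt (𝓡 d) c).source ∧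
      ContMDiff (𝓡 d) 𝓘(ℝ, ℝ × EuclideanSpace ℝ (Fin d)) 1 θ ∧
      (∀ x y, edist (θ x) (θ y) ≤ A * F.finslerEDist x y) ∧ (∀ x y, dist (θ x) (θ y) ≤ R) ∧
      ∀ x ∈ V, ∀ y, dist (θ x) (θ y) < 1 / 2 → y ∈ (extChartAt (𝓡 d) c).source ∧
        dist (extChartAt (𝓡 d) c x) (extChartAt (𝓡 d) c y) ≤ K * dist (θ x) (θ y)) := by
    intro c
    by_cases hc : c ∈ Λ
    · obtain ⟨θ, V, A, R, K, h⟩ := exists_lipschitz_chart_extension F c (hO c hc)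
      exact ⟨θ, V, A, R, K, fun _ => h⟩
    -- Dummy data away from `Λ`, so that the choice below is defined for every `c`.
    · exact ⟨fun _ => 0, ∅, 0, 0, 0, fun h => absurd h hc⟩
  choose θ V A R K hkey using key
  obtain ⟨S, hSΛ, hcover⟩ := hΛ.elim_nhds_subcover (fun c => interior (V c))
    fun c hc => interior_mem_nhds.2 (hkey c hc).2.1
  have hle : ∀ x y (c : S), dist (θ c x) (θ c y) ≤
      dist (fun c : S => θ c x) (fun c : S => θ c y) := fun x y c =>
    dist_le_pi_dist (fun c : S => θ c x) (fun c : S => θ c y) c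
  have hK : ∀ c ∈ S, ∀ x ∈ V c, ∀ y,
      dist (fun c : S => θ c x) (fun c : S => θ c y) < 1 / 2 →
      y ∈ (extChartAt (𝓡 d) c).source ∧ dist (extChartAt (𝓡 d) c x) (extChartAt (𝓡 d) c y) ≤
        (∑ c ∈ S, |K c|) * dist (fun c : S => θ c x) (fun c : S => θ c y) := by
    intro c hc x hx y hxy
    have h1 := hle x y ⟨c, hc⟩
    obtain ⟨h2, h3⟩ := (hkey c (hSΛ c hc)).2.2.2.2.2.2.2 x hx y (h1.trans_lt hxy)
    refine ⟨h2, h3.trans ?_⟩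
    refine mul_le_mul ((le_abs_self _).trans ?_) h1 dist_nonneg
      (Finset.sum_nonneg fun c _ => abs_nonneg _)
    exact Finset.single_le_sum (f := fun c => |K c|) (fun _ _ => abs_nonneg _) hc
  refine ⟨⟨S, V, fun x c => θ c x, ∑ c ∈ S, A c, ∑ c ∈ S, |R c|, ∑ c ∈ S, |K c|,
    fun c hc => (hkey c (hSΛ c hc)).1, fun c hc => (hkey c (hSΛ c hc)).2.2.2.1, ?_, ?_, ?_,
    Finset.sum_nonneg fun c _ => abs_nonneg _, ?_, Finset.sum_nonneg fun c _ => abs_nonneg _,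
    fun c hc x hx y hxy => (hK c hc x hx y hxy).1, fun c hc x hx y hxy => (hK c hc x hx y hxy).2⟩,
    fun c hc => ⟨hSΛ c hc, (hkey c (hSΛ c hc)).2.2.1⟩⟩
  · intro x hx
    obtain ⟨c, hc, hxc⟩ := mem_iUnion₂.1 (hcover hx)
    exact ⟨c, hc, mem_interior_iff_mem_nhds.1 hxc⟩
  · rw [contMDiff_pi_space]
    intro c
    exact (hkey c (hSΛ c c.2)).2.2.2.2.1
  · intro x y
    refine (edist_pi_le_iff).2 fun c => ?_
    refine ((hkey c (hSΛ c c.2)).2.2.2.2.2.1 x y).trans ?_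
    refine mul_le_mul_left ?_ _
    exact_mod_cast Finset.single_le_sum (f := A) (fun _ _ => zero_le) c.2
  · intro x y
    refine (dist_pi_le_iff (Finset.sum_nonneg fun c _ => abs_nonneg _)).2 fun c => ?_
    refine ((hkey c (hSΛ c c.2)).2.2.2.2.2.2.1 x y).trans ((le_abs_self _).trans ?_)
    exact Finset.single_le_sum (f := fun c => |R c|) (fun _ _ => abs_nonneg _) c.2

end Separation

/-! ### Uniformity near a compact set -/

/-- A locally uniform property of pairs of points of a compact set is uniform near this set. -/
theorem exists_isOpen_of_eventually_prod {M : Type*} [TopologicalSpace M] {Λ : Set M}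
    (hΛ : IsCompact Λ) (P : ℝ → M → M → Prop)
    (hmono : ∀ s t x y, s ≤ t → P s x y → P t x y)
    (h : ∀ a ∈ Λ, ∀ b ∈ Λ, ∃ t, ∀ᶠ p in 𝓝 (a, b), P t p.1 p.2) :
    ∃ t, ∃ Ω : Set M, IsOpen Ω ∧ Λ ⊆ Ω ∧ ∀ x ∈ Ω, ∀ y ∈ Ω, P t x y := by
  have key : ∃ t, ∃ W : Set (M × M), IsOpen W ∧ Λ ×ˢ Λ ⊆ W ∧ ∀ p ∈ W, P t p.1 p.2 := by
    refine (hΛ.prod hΛ).induction_on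
      (p := fun s => ∃ t, ∃ W : Set (M × M), IsOpen W ∧ s ⊆ W ∧ ∀ p ∈ W, P t p.1 p.2) ?_ ?_ ?_ ?_
    · exact ⟨0, ∅, isOpen_empty, Subset.rfl, fun _ h => h.elim⟩
    · rintro s s' hss ⟨t, W, h1, h2, h3⟩
      exact ⟨t, W, h1, hss.trans h2, h3⟩
    · rintro s s' ⟨t, W, h1, h2, h3⟩ ⟨t', W', h1', h2', h3'⟩
      refine ⟨max t t', W ∪ W', h1.union h1', union_subset_union h2 h2', ?_⟩
      rintro p (hp | hp)
      · exact hmono _ _ _ _ (le_max_left _ _) (h3 p hp)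
      · exact hmono _ _ _ _ (le_max_right _ _) (h3' p hp)
    · rintro ⟨a, b⟩ ⟨ha, hb⟩
      obtain ⟨t, ht⟩ := h a ha b hb
      obtain ⟨W, hW, hWo, hab⟩ := eventually_nhds_iff.1 ht
      exact ⟨W, mem_nhdsWithin_of_mem_nhds (hWo.mem_nhds hab), t, W, hWo, Subset.rfl, hW⟩
  obtain ⟨t, W, hWo, hΛW, hW⟩ := key
  -- The tube lemma puts a product between `Λ ×ˢ Λ` and its neighbourhood; intersecting the two
  -- factors gives a single neighbourhood of `Λ`.
  obtain ⟨u, v, hu, hv, hΛu, hΛv, huv⟩ := generalized_tube_lemma hΛ hΛ hWo hΛW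
  exact ⟨t, u ∩ v, hu.inter hv, subset_inter hΛu hΛv, fun x hx y hy => hW (x, y) (huv ⟨hx.1, hy.2⟩)⟩

/-! ### Lipschitz estimates with respect to the separating map -/

section Lipschitz

variable {d : ℕ} {M : Type*} [TopologicalSpace M]
  [ChartedSpace (EuclideanSpace ℝ (Fin d)) M] [IsManifold (𝓡 d) 1 M]

/-- A `C¹` map is locally Lipschitz in charts. -/
theorem ContMDiff.exists_dist_le_extChartAt {Z : Type*} [NormedAddCommGroup Z] [NormedSpace ℝ Z]
    {h : M → Z} (hh : ContMDiff (𝓡 d) 𝓘(ℝ, Z) 1 h) {c y : M}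
    (hy : y ∈ (extChartAt (𝓡 d) c).source) :
    ∃ A : ℝ, ∃ W ∈ 𝓝 y, ∀ x ∈ W, ∀ x' ∈ W,
      dist (h x) (h x') ≤ A * dist (extChartAt (𝓡 d) c x) (extChartAt (𝓡 d) c x') := by
  set e := extChartAt (𝓡 d) c with he
  have hey : e y ∈ e.target := e.map_source hy
  have h1 : ContDiffAt ℝ 1 (h ∘ e.symm) (e y) := by
    rw [← contMDiffAt_iff_contDiffAt]
    refine ContMDiffAt.comp (e y) (hh _) ?_
    exact (contMDiffOn_extChartAt_symm c _ hey).contMDiffAt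
      ((isOpen_extChartAt_target c).mem_nhds hey)
  obtain ⟨A, t, ht, hA⟩ := h1.exists_lipschitzOnWith
  refine ⟨A, e.source ∩ e ⁻¹' t, Filter.inter_mem ((isOpen_extChartAt_source c).mem_nhds hy)
    ((continuousAt_extChartAt' hy).preimage_mem_nhds ht), ?_⟩
  rintro x ⟨hx, hxt⟩ x' ⟨hx', hxt'⟩
  have := hA.dist_le_mul _ hxt _ hxt'
  simpa only [Function.comp, e.left_inv hx, e.left_inv hx'] using this

namespace FinslerNorm

/-- A Lipschitz function for the Finsler distance is locally Lipschitz in charts. -/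
theorem IsLipschitz.exists_dist_le_extChartAt {F : FinslerNorm d M} {φ : M → ℝ}
    (hφ : F.IsLipschitz φ) {c y : M} (hy : y ∈ (extChartAt (𝓡 d) c).source) :
    ∃ A : ℝ, ∃ W ∈ 𝓝 y, ∀ x ∈ W, ∀ x' ∈ W,
      dist (φ x) (φ x') ≤ A * dist (extChartAt (𝓡 d) c x) (extChartAt (𝓡 d) c x') := by
  obtain ⟨K, hK⟩ := hφ
  obtain ⟨A, W, hW, hA⟩ := F.exists_finslerEDist_le_edist_extChartAt
    (by rwa [extChartAt_source] at hy : y ∈ (chartAt (EuclideanSpace ℝ (Fin d)) c).source)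
  refine ⟨(K * A : ℝ≥0), W, hW, fun x hx x' hx' => ?_⟩
  have h1 : edist (φ x) (φ x') ≤
      (K * A : ℝ≥0) * edist (extChartAt (𝓡 d) c x) (extChartAt (𝓡 d) c x') := by
    refine (hK x x').trans ?_
    rw [ENNReal.coe_mul, mul_assoc]
    exact mul_le_mul_right (hA x hx x' hx') _
  rw [edist_nndist, edist_nndist] at h1
  exact_mod_cast h1

end FinslerNorm

omit [IsManifold (𝓡 d) 1 M] in
theorem continuousAt_of_dist_le_extChartAt {Z : Type*} [PseudoMetricSpace Z]
    {h : M → Z} {c y : M} (hy : y ∈ (extChartAt (𝓡 d) c).source) {A : ℝ} {W : Set M}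
    (hW : W ∈ 𝓝 y) (hA : ∀ x ∈ W, ∀ x' ∈ W,
      dist (h x) (h x') ≤ A * dist (extChartAt (𝓡 d) c x) (extChartAt (𝓡 d) c x')) :
    ContinuousAt h y := by
  rw [ContinuousAt, tendsto_iff_dist_tendsto_zero]
  have h1 : Filter.Tendsto (fun x => A * dist (extChartAt (𝓡 d) c x) (extChartAt (𝓡 d) c y))
      (𝓝 y) (𝓝 0) := by
    have := (tendsto_iff_dist_tendsto_zero.1 (continuousAt_extChartAt' (I := 𝓡 d) hy)).const_mul A
    rwa [mul_zero] at this
  refine squeeze_zero' (Filter.Eventually.of_forall fun _ => dist_nonneg) ?_ h1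
  filter_upwards [hW] with x hx using hA x hx y (mem_of_mem_nhds hW)

variable {F : FinslerNorm d M} {Λ : Set M}

namespace ChartCover

/-- Distance 0 is below the threshold `1/2`, so `y` lies in a chart around `x` and has the same
coordinates there. Only one of the points has to be in `Λ`. -/
theorem eq_of_dist_eq_zero (cov : ChartCover F Λ) {x y : M} (hx : x ∈ Λ)
    (h : dist (cov.Θ x) (cov.Θ y) = 0) : x = y := by
  obtain ⟨c, hc, hxc⟩ := cov.exists_mem_nhds x hx
  have hxV := mem_of_mem_nhds hxc
  have h1 := cov.mem_source c hc x hxV y (by rw [h]; norm_num)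
  have h2 := cov.dist_extChartAt_le c hc x hxV y (by rw [h]; norm_num)
  rw [h, mul_zero] at h2
  exact (extChartAt (𝓡 d) c).injOn (cov.V_subset c hc hxV) h1
    (dist_le_zero.1 h2)

/-- A map which is locally Lipschitz in charts is Lipschitz near `Λ` for the distance induced by
the separating map. -/
theorem exists_dist_le_of_locally (cov : ChartCover F Λ) (hΛ : IsCompact Λ) {Z : Type*}
    [PseudoMetricSpace Z] {h : M → Z}
    (hh : ∀ c ∈ cov.S, ∀ y ∈ (extChartAt (𝓡 d) c).source, ∃ A : ℝ, ∃ W ∈ 𝓝 y, ∀ x ∈ W, ∀ x' ∈ W,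
      dist (h x) (h x') ≤ A * dist (extChartAt (𝓡 d) c x) (extChartAt (𝓡 d) c x')) :
    ∃ A : ℝ, 0 ≤ A ∧ ∃ Ω : Set M, IsOpen Ω ∧ Λ ⊆ Ω ∧
      ∀ x ∈ Ω, ∀ y ∈ Ω, dist (h x) (h y) ≤ A * dist (cov.Θ x) (cov.Θ y) := by
  have hcont : ∀ y ∈ Λ, ContinuousAt h y := by
    intro y hy
    obtain ⟨c, hc, hyc⟩ := cov.exists_mem_nhds y hy
    have hys := cov.V_subset c hc (mem_of_mem_nhds hyc)
    obtain ⟨A, W, hW, hA⟩ := hh c hc y hys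
    exact continuousAt_of_dist_le_extChartAt hys hW hA
  have hΘ := cov.contMDiff.continuous
  obtain ⟨A, Ω, hΩ, hΛΩ, hA⟩ := exists_isOpen_of_eventually_prod hΛ
    (fun t x y => dist (h x) (h y) ≤ t * dist (cov.Θ x) (cov.Θ y))
    (fun s t x y hst hs => hs.trans (mul_le_mul_of_nonneg_right hst dist_nonneg)) (by
      intro a ha b hb
      -- Near the diagonal the chart estimate applies. Away from it, the separating distance is
      -- bounded below and a crude quotient suffices.
      by_cases hab : a = b
      · subst hab
        obtain ⟨c, hc, hac⟩ := cov.exists_mem_nhds a ha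
        have has := cov.V_subset c hc (mem_of_mem_nhds hac)
        obtain ⟨A, W, hW, hA⟩ := hh c hc a has
        refine ⟨|A| * cov.K, ?_⟩
        have hd : ∀ᶠ p : M × M in 𝓝 (a, a), dist (cov.Θ p.1) (cov.Θ p.2) < 1 / 2 := by
          have : Continuous fun p : M × M => dist (cov.Θ p.1) (cov.Θ p.2) := by fun_prop
          refine (this.tendsto (a, a)).eventually_lt_const ?_
          simp
        filter_upwards [hd, prod_mem_nhds (Filter.inter_mem hW hac) hW] with p hp hpW
        refine (hA _ hpW.1.1 _ hpW.2).trans ?_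
        rw [mul_assoc]
        exact mul_le_mul (le_abs_self _) (cov.dist_extChartAt_le c hc _ hpW.1.2 _ hp) dist_nonneg
          (abs_nonneg _)
      · have hpos : 0 < dist (cov.Θ a) (cov.Θ b) :=
          lt_of_le_of_ne dist_nonneg fun h0 => hab (cov.eq_of_dist_eq_zero ha h0.symm)
        refine ⟨(dist (h a) (h b) + 1) / (dist (cov.Θ a) (cov.Θ b) / 2), ?_⟩
        have h1 : ∀ᶠ p : M × M in 𝓝 (a, b),
            dist (cov.Θ a) (cov.Θ b) / 2 < dist (cov.Θ p.1) (cov.Θ p.2) := by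
          have : Continuous fun p : M × M => dist (cov.Θ p.1) (cov.Θ p.2) := by fun_prop
          exact (this.tendsto (a, b)).eventually_const_lt (by simpa using hpos)
        have h2 : ∀ᶠ p : M × M in 𝓝 (a, b), dist (h p.1) (h p.2) < dist (h a) (h b) + 1 := by
          have h3 : ContinuousAt (fun p : M × M => dist (h p.1) (h p.2)) (a, b) :=
            ((hcont a ha).comp' continuousAt_fst).dist ((hcont b hb).comp' continuousAt_snd)
          exact h3.tendsto.eventually_lt_const (by simp)
        filter_upwards [h1, h2] with p hp1 hp2
        rw [div_mul_eq_mul_div, le_div_iff₀ (by positivity)]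
        exact mul_le_mul hp2.le hp1.le (by positivity) (by positivity))
  refine ⟨|A|, abs_nonneg _, Ω, hΩ, hΛΩ, fun x hx y hy => (hA x hx y hy).trans ?_⟩
  exact mul_le_mul_of_nonneg_right (le_abs_self _) dist_nonneg

end ChartCover

end Lipschitz

/-! ### Linear coordinates adapted to the splitting -/

section Frames

theorem linearCombination_coprod_properties {T α β : Type*} [AddCommGroup T] [Module ℝ T]
    [Fintype α] [Fintype β] {s : α → T} {t : β → T} (hs : LinearIndependent ℝ s)
    (ht : LinearIndependent ℝ t) {U W : Submodule ℝ T} (hU : Submodule.span ℝ (range s) = U)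
    (hW : Submodule.span ℝ (range t) = W) (hUW : Disjoint U W) :
    Function.Injective
      ((Fintype.linearCombination ℝ s).coprod (Fintype.linearCombination ℝ t)) ∧
    ∀ ξ : (α → ℝ) × (β → ℝ),
      (((Fintype.linearCombination ℝ s).coprod (Fintype.linearCombination ℝ t)) ξ ∈ U ↔
        ξ.2 = 0) ∧
      (((Fintype.linearCombination ℝ s).coprod (Fintype.linearCombination ℝ t)) ξ ∈ W ↔
        ξ.1 = 0) := by
  have is : Function.Injective (Fintype.linearCombination ℝ s) :=
    hs.fintypeLinearCombination_injective
  have it : Function.Injective (Fintype.linearCombination ℝ t) :=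
    ht.fintypeLinearCombination_injective
  have ms : ∀ a, Fintype.linearCombination ℝ s a ∈ U := fun a => by
    rw [← hU, ← Fintype.range_linearCombination]
    exact LinearMap.mem_range_self _ a
  have mt : ∀ a, Fintype.linearCombination ℝ t a ∈ W := fun a => by
    rw [← hW, ← Fintype.range_linearCombination]
    exact LinearMap.mem_range_self _ a
  have h1 : ∀ ξ : (α → ℝ) × (β → ℝ),
      (((Fintype.linearCombination ℝ s).coprod (Fintype.linearCombination ℝ t)) ξ ∈ U ↔
        ξ.2 = 0) := by
    intro ξ
    rw [LinearMap.coprod_apply, Submodule.add_mem_iff_right _ (ms _)]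
    refine ⟨fun h => ?_, fun h => by rw [h, map_zero]; exact zero_mem _⟩
    exact it ((Submodule.disjoint_def.1 hUW _ h (mt _)).trans (map_zero _).symm)
  have h2 : ∀ ξ : (α → ℝ) × (β → ℝ),
      (((Fintype.linearCombination ℝ s).coprod (Fintype.linearCombination ℝ t)) ξ ∈ W ↔
        ξ.1 = 0) := by
    intro ξ
    rw [LinearMap.coprod_apply, Submodule.add_mem_iff_left _ (mt _)]
    refine ⟨fun h => ?_, fun h => by rw [h, map_zero]; exact zero_mem _⟩
    exact is ((Submodule.disjoint_def.1 hUW _ (ms _) h).trans (map_zero _).symm)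
  refine ⟨(injective_iff_map_eq_zero _).2 fun ξ hξ => ?_, fun ξ => ⟨h1 ξ, h2 ξ⟩⟩
  exact Prod.ext ((h2 ξ).1 (hξ ▸ zero_mem _)) ((h1 ξ).1 (hξ ▸ zero_mem _))

variable {d : ℕ} {M : Type*} [TopologicalSpace M]
  [ChartedSpace (EuclideanSpace ℝ (Fin d)) M] [IsManifold (𝓡 d) 1 M]

/-- Linear coordinates adapted to a continuous splitting, in a chart. -/
structure IsAdaptedFrame (Λ V : Set M) (c : M) {du ds : ℕ}
    (Eu Es : ∀ x : M, Submodule ℝ (TangentSpace (𝓡 d) x))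
    (B : M → ((Fin du → ℝ) × (Fin ds → ℝ)) →L[ℝ] EuclideanSpace ℝ (Fin d))
    (B' : M → EuclideanSpace ℝ (Fin d) →L[ℝ] ((Fin du → ℝ) × (Fin ds → ℝ))) : Prop where
  subset_source : V ⊆ (extChartAt (𝓡 d) c).source
  continuousOn : ContinuousOn B (V ∩ Λ)
  continuousOn' : ContinuousOn B' (V ∩ Λ)
  left_inv : ∀ y ∈ V ∩ Λ, ∀ ξ, B' y (B y ξ) = ξ
  right_inv : ∀ y ∈ V ∩ Λ, ∀ w, B y (B' y w) = w
  mem_Eu : ∀ y ∈ V ∩ Λ, ∀ v : TangentSpace (𝓡 d) y, v ∈ Eu y ↔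
    (B' y (mfderiv (𝓡 d) 𝓘(ℝ, EuclideanSpace ℝ (Fin d)) (extChartAt (𝓡 d) c) y v)).2 = 0
  mem_Es : ∀ y ∈ V ∩ Λ, ∀ v : TangentSpace (𝓡 d) y, v ∈ Es y ↔
    (B' y (mfderiv (𝓡 d) 𝓘(ℝ, EuclideanSpace ℝ (Fin d)) (extChartAt (𝓡 d) c) y v)).1 = 0

omit [IsManifold (𝓡 d) 1 M] in
theorem IsAdaptedFrame.mono {Λ V V' : Set M} {c : M} {du ds : ℕ}
    {Eu Es : ∀ x : M, Submodule ℝ (TangentSpace (𝓡 d) x)}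
    {B : M → ((Fin du → ℝ) × (Fin ds → ℝ)) →L[ℝ] EuclideanSpace ℝ (Fin d)}
    {B' : M → EuclideanSpace ℝ (Fin d) →L[ℝ] ((Fin du → ℝ) × (Fin ds → ℝ))}
    (h : IsAdaptedFrame Λ V c Eu Es B B') (hV : V' ⊆ V) : IsAdaptedFrame Λ V' c Eu Es B B' where
  subset_source := hV.trans h.subset_source
  continuousOn := h.continuousOn.mono (inter_subset_inter_left _ hV)
  continuousOn' := h.continuousOn'.mono (inter_subset_inter_left _ hV)
  left_inv y hy := h.left_inv y ⟨hV hy.1, hy.2⟩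
  right_inv y hy := h.right_inv y ⟨hV hy.1, hy.2⟩
  mem_Eu y hy := h.mem_Eu y ⟨hV hy.1, hy.2⟩
  mem_Es y hy := h.mem_Es y ⟨hV hy.1, hy.2⟩

/-- Local bases of the two bundles together form a basis of each tangent space. Transported by the
derivative of the chart they give `B`, whose inverse is continuous because inversion of operators
is. Membership in `Eu` or `Es` becomes the vanishing of a block of coordinates. -/
theorem exists_isAdaptedFrame {Λ : Set M} {du ds : ℕ} (hd : d = du + ds)
    {Eu Es : ∀ x : M, Submodule ℝ (TangentSpace (𝓡 d) x)}
    (hEu : IsContinuousSubbundleOn Λ du Eu) (hEs : IsContinuousSubbundleOn Λ ds Es)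
    (hcompl : ∀ x ∈ Λ, IsCompl (Eu x) (Es x)) {c : M} (hc : c ∈ Λ) :
    ∃ V ∈ 𝓝 c, ∃ (B : M → ((Fin du → ℝ) × (Fin ds → ℝ)) →L[ℝ] EuclideanSpace ℝ (Fin d))
      (B' : M → EuclideanSpace ℝ (Fin d) →L[ℝ] ((Fin du → ℝ) × (Fin ds → ℝ))),
      IsAdaptedFrame Λ V c Eu Es B B' := by
  obtain ⟨W₁, hW₁, s, hsc, hs⟩ := hEu c hc
  obtain ⟨W₂, hW₂, t, htc, ht⟩ := hEs c hc
  set V := W₁ ∩ W₂ ∩ (extChartAt (𝓡 d) c).source with hV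
  have hVn : V ∈ 𝓝 c := Filter.inter_mem (Filter.inter_mem hW₁ hW₂)
    ((isOpen_extChartAt_source c).mem_nhds (mem_extChartAt_source c))
  let D : ∀ y : M, TangentSpace (𝓡 d) y →ₗ[ℝ] EuclideanSpace ℝ (Fin d) := fun y =>
    (mfderiv (𝓡 d) 𝓘(ℝ, EuclideanSpace ℝ (Fin d)) (extChartAt (𝓡 d) c) y).toLinearMap
  have hDinj : ∀ y ∈ V, Function.Injective (D y) := fun y hy =>
    mfderiv_extChartAt_injective (by simpa using hy.2)
  let R : ∀ y : M, ((Fin du → ℝ) × (Fin ds → ℝ)) →ₗ[ℝ] TangentSpace (𝓡 d) y := fun y =>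
    (Fintype.linearCombination ℝ (fun i => s i y)).coprod
      (Fintype.linearCombination ℝ (fun i => t i y))
  have hR : ∀ y ∈ V ∩ Λ, Function.Injective (R y) ∧ ∀ ξ, (R y ξ ∈ Eu y ↔ ξ.2 = 0) ∧
      (R y ξ ∈ Es y ↔ ξ.1 = 0) := fun y hy =>
    linearCombination_coprod_properties (hs y ⟨hy.1.1.1, hy.2⟩).1 (ht y ⟨hy.1.1.2, hy.2⟩).1
      (hs y ⟨hy.1.1.1, hy.2⟩).2 (ht y ⟨hy.1.1.2, hy.2⟩).2 (hcompl y hy.2).disjoint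
  let B : M → ((Fin du → ℝ) × (Fin ds → ℝ)) →L[ℝ] EuclideanSpace ℝ (Fin d) := fun y =>
    LinearMap.toContinuousLinearMap (D y ∘ₗ R y)
  have hBapp : ∀ y ξ, B y ξ = D y (R y ξ) := fun y ξ => rfl
  have hinv : ∀ y ∈ V ∩ Λ, ∃ e : ((Fin du → ℝ) × (Fin ds → ℝ)) ≃L[ℝ] EuclideanSpace ℝ (Fin d),
      (e : ((Fin du → ℝ) × (Fin ds → ℝ)) →L[ℝ] EuclideanSpace ℝ (Fin d)) = B y := by
    intro y hy
    have hinj : Function.Injective (D y ∘ₗ R y) := (hDinj y hy.1).comp (hR y hy).1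
    refine ⟨(LinearEquiv.ofInjectiveOfFinrankEq (D y ∘ₗ R y) hinj ?_).toContinuousLinearEquiv, ?_⟩
    · simp [hd]
    · exact ContinuousLinearMap.ext fun ξ => rfl
  have hBcont : ContinuousOn B (V ∩ Λ) := by
    rw [continuousOn_clm_apply]
    intro ξ
    have hcs : ∀ i, ContinuousOn (fun y => D y (s i y)) (V ∩ Λ) := fun i =>
      (continuousOn_mfderiv_extChartAt c).comp
        ((hsc i).mono fun y hy => ⟨hy.1.1.1, hy.2⟩) fun y hy => by simpa using hy.1.2
    have hct : ∀ i, ContinuousOn (fun y => D y (t i y)) (V ∩ Λ) := fun i =>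
      (continuousOn_mfderiv_extChartAt c).comp
        ((htc i).mono fun y hy => ⟨hy.1.1.2, hy.2⟩) fun y hy => by simpa using hy.1.2
    have heq : (fun y => B y ξ) = fun y =>
        ∑ i, ξ.1 i • D y (s i y) + ∑ i, ξ.2 i • D y (t i y) := by
      funext y
      rw [hBapp]
      simp only [R, LinearMap.coprod_apply, Fintype.linearCombination_apply, map_add, map_sum,
        map_smul]
    rw [heq]
    have h1 : ∀ (n : ℕ) (a : Fin n → ℝ) (w : Fin n → M → EuclideanSpace ℝ (Fin d)),
        (∀ i, ContinuousOn (w i) (V ∩ Λ)) →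
        ContinuousOn (fun y => ∑ i, a i • w i y) (V ∩ Λ) := fun n a w hw =>
      continuousOn_finsetSum _ fun i _ => (hw i).fun_const_smul (a i)
    exact (h1 du ξ.1 _ hcs).add (h1 ds ξ.2 _ hct)
  have hright : ∀ y ∈ V ∩ Λ, ∀ w, B y ((B y).inverse w) = w := by
    intro y hy w
    obtain ⟨e, he⟩ := hinv y hy
    rw [← he, ContinuousLinearMap.inverse_equiv]
    exact e.apply_symm_apply w
  have hrep : ∀ y ∈ V ∩ Λ, ∀ v : TangentSpace (𝓡 d) y, R y ((B y).inverse (D y v)) = v := by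
    intro y hy v
    apply hDinj y hy.1
    rw [← hBapp]
    exact hright y hy _
  refine ⟨V, hVn, B, fun y => (B y).inverse, inter_subset_right, hBcont, ?_, ?_, hright, ?_, ?_⟩
  · intro y hy
    obtain ⟨e, he⟩ := hinv y hy
    have h1 : ContinuousAt (ContinuousLinearMap.inverse :
        (((Fin du → ℝ) × (Fin ds → ℝ)) →L[ℝ] EuclideanSpace ℝ (Fin d)) → _) (B y) := by
      rw [← he]
      exact (contDiffAt_map_inverse (𝕜 := ℝ) (n := 0) e).continuousAt
    exact h1.comp_continuousWithinAt (hBcont y hy)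
  · intro y hy ξ
    obtain ⟨e, he⟩ := hinv y hy
    rw [← he, ContinuousLinearMap.inverse_equiv]
    exact e.symm_apply_apply ξ
  · intro y hy v
    have := ((hR y hy).2 ((B y).inverse (D y v))).1
    rw [hrep y hy v] at this
    exact this
  · intro y hy v
    have := ((hR y hy).2 ((B y).inverse (D y v))).2
    rw [hrep y hy v] at this
    exact this

/-- Over a compact set, an adapted frame has bounded distortion. -/
theorem IsAdaptedFrame.exists_bound (F : FinslerNorm d M) {Λ V : Set M} {c : M} {du ds : ℕ}
    {Eu Es : ∀ x : M, Submodule ℝ (TangentSpace (𝓡 d) x)}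
    {B : M → ((Fin du → ℝ) × (Fin ds → ℝ)) →L[ℝ] EuclideanSpace ℝ (Fin d)}
    {B' : M → EuclideanSpace ℝ (Fin d) →L[ℝ] ((Fin du → ℝ) × (Fin ds → ℝ))}
    (h : IsAdaptedFrame Λ V c Eu Es B B') (hV : IsCompact (V ∩ Λ)) :
    ∃ D : ℝ, ∀ y ∈ V ∩ Λ, ‖B y‖ ≤ D ∧ ‖B' y‖ ≤ D ∧ ∀ v : TangentSpace (𝓡 d) y,
      ‖B' y (mfderiv (𝓡 d) 𝓘(ℝ, EuclideanSpace ℝ (Fin d)) (extChartAt (𝓡 d) c) y v)‖ ≤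
        D * F.norm y v ∧
      F.norm y v ≤ D *
        ‖B' y (mfderiv (𝓡 d) 𝓘(ℝ, EuclideanSpace ℝ (Fin d)) (extChartAt (𝓡 d) c) y v)‖ := by
  have hsub : V ∩ Λ ⊆ (chartAt (EuclideanSpace ℝ (Fin d)) c).source := fun y hy => by
    simpa using h.subset_source hy.1
  let n : ∀ x : M, TangentSpace (𝓡 d) x → ℝ := fun x v =>
    Norm.norm (E := EuclideanSpace ℝ (Fin d))
      (mfderiv (𝓡 d) 𝓘(ℝ, EuclideanSpace ℝ (Fin d)) (extChartAt (𝓡 d) c) x v)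
  have hn : ∀ x (a : ℝ) v, n x (a • v) = |a| * n x v := fun x a v =>
    norm_mfderiv_smul _ x a v
  obtain ⟨A₁, hA₁, h₁⟩ := exists_le_mul_of_isCompact c hV hsub n (fun x v => F.norm x v)
    (continuousOn_mfderiv_extChartAt c).norm F.continuous.continuousOn (fun x _ => hn x)
    (fun x _ a v => F.norm_smul_eq x a v) (fun x _ v hv => F.pos x v hv)
  obtain ⟨A₂, hA₂, h₂⟩ := exists_le_mul_of_isCompact c hV hsub (fun x v => F.norm x v) n
    F.continuous.continuousOn (continuousOn_mfderiv_extChartAt c).norm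
    (fun x _ a v => F.norm_smul_eq x a v) (fun x _ => hn x)
    (fun x hx v hv => by
      refine (norm_pos_iff (E := EuclideanSpace ℝ (Fin d))).2 fun h => ?_
      exact hv (mfderiv_extChartAt_injective (hsub hx) (h.trans (map_zero _).symm)))
  obtain ⟨D₁, hD₁⟩ := hV.exists_bound_of_continuousOn h.continuousOn
  obtain ⟨D₂, hD₂⟩ := hV.exists_bound_of_continuousOn h.continuousOn'
  refine ⟨max (max D₁ D₂) (max (D₂ * A₁) (A₂ * D₁)), fun y hy => ⟨?_, ?_, fun v => ⟨?_, ?_⟩⟩⟩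
  · exact (hD₁ y hy).trans ((le_max_left _ _).trans (le_max_left _ _))
  · exact (hD₂ y hy).trans ((le_max_right _ _).trans (le_max_left _ _))
  · have hv : 0 ≤ F.norm y v := apply_nonneg _ _
    refine ((B' y).le_opNorm _).trans ?_
    refine (mul_le_mul (hD₂ y hy) (h₁ y hy v) (norm_nonneg _)
      ((norm_nonneg _).trans (hD₂ y hy))).trans ?_
    rw [← mul_assoc]
    exact mul_le_mul_of_nonneg_right ((le_max_left _ _).trans (le_max_right _ _)) hv
  · refine (h₂ y hy v).trans ?_
    have h3 : n y v ≤ D₁ * ‖B' y (mfderiv (𝓡 d) 𝓘(ℝ, EuclideanSpace ℝ (Fin d))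
        (extChartAt (𝓡 d) c) y v)‖ := by
      have := (B y).le_of_opNorm_le (hD₁ y hy)
        (B' y (mfderiv (𝓡 d) 𝓘(ℝ, EuclideanSpace ℝ (Fin d)) (extChartAt (𝓡 d) c) y v))
      exact (congrArg (Norm.norm (E := EuclideanSpace ℝ (Fin d)))
        (h.right_inv y hy _)).symm.trans_le this
    refine (mul_le_mul_of_nonneg_left h3 hA₂.le).trans ?_
    rw [← mul_assoc]
    exact mul_le_mul_of_nonneg_right ((le_max_right _ _).trans (le_max_right _ _)) (norm_nonneg _)

end Frames

/-! ### The derivative in adapted coordinates -/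

section Shadowing

variable {d : ℕ} {M : Type*} [TopologicalSpace M]
  [ChartedSpace (EuclideanSpace ℝ (Fin d)) M] [IsManifold (𝓡 d) 1 M]

/-- A cover by charts with linear coordinates adapted to a splitting, of bounded distortion. -/
structure AdaptedCover (F : FinslerNorm d M) (Λ : Set M) (du ds : ℕ)
    (Eu Es : ∀ x : M, Submodule ℝ (TangentSpace (𝓡 d) x)) extends ChartCover F Λ where
  /-- The frames, in the charts. -/
  B : M → M → ((Fin du → ℝ) × (Fin ds → ℝ)) →L[ℝ] EuclideanSpace ℝ (Fin d)
  /-- The inverses of the frames. -/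
  B' : M → M → EuclideanSpace ℝ (Fin d) →L[ℝ] ((Fin du → ℝ) × (Fin ds → ℝ))
  /-- The distortion bound. -/
  D : ℝ
  isAdaptedFrame : ∀ c ∈ S, IsAdaptedFrame Λ (V c) c Eu Es (B c) (B' c)
  one_le_D : 1 ≤ D
  norm_B_le : ∀ c ∈ S, ∀ y ∈ V c ∩ Λ, ‖B c y‖ ≤ D
  norm_B'_le : ∀ c ∈ S, ∀ y ∈ V c ∩ Λ, ‖B' c y‖ ≤ D
  norm_coord_le : ∀ c ∈ S, ∀ y ∈ V c ∩ Λ, ∀ v : TangentSpace (𝓡 d) y,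
    ‖B' c y (mfderiv (𝓡 d) 𝓘(ℝ, EuclideanSpace ℝ (Fin d)) (extChartAt (𝓡 d) c) y v)‖ ≤
      D * F.norm y v
  norm_le_coord : ∀ c ∈ S, ∀ y ∈ V c ∩ Λ, ∀ v : TangentSpace (𝓡 d) y,
    F.norm y v ≤ D *
      ‖B' c y (mfderiv (𝓡 d) 𝓘(ℝ, EuclideanSpace ℝ (Fin d)) (extChartAt (𝓡 d) c) y v)‖

/-- The chart pieces are chosen inside the domains of the frames. Their intersections with `Λ` are
compact, so one constant `D` bounds the distortion of all of them. -/
theorem exists_adaptedCover [T2Space M] (F : FinslerNorm d M) {Λ : Set M} (hΛ : IsCompact Λ)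
    {du ds : ℕ} (hd : d = du + ds)
    {Eu Es : ∀ x : M, Submodule ℝ (TangentSpace (𝓡 d) x)}
    (hEu : IsContinuousSubbundleOn Λ du Eu) (hEs : IsContinuousSubbundleOn Λ ds Es)
    (hcompl : ∀ x ∈ Λ, IsCompl (Eu x) (Es x)) : Nonempty (AdaptedCover F Λ du ds Eu Es) := by
  have key : ∀ c : M, ∃ (V : Set M)
      (B : M → ((Fin du → ℝ) × (Fin ds → ℝ)) →L[ℝ] EuclideanSpace ℝ (Fin d))
      (B' : M → EuclideanSpace ℝ (Fin d) →L[ℝ] ((Fin du → ℝ) × (Fin ds → ℝ))),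
      c ∈ Λ → (V ∈ 𝓝 c ∧ IsAdaptedFrame Λ V c Eu Es B B') := by
    intro c
    by_cases hc : c ∈ Λ
    · obtain ⟨V, hV, B, B', h⟩ := exists_isAdaptedFrame hd hEu hEs hcompl hc
      exact ⟨V, B, B', fun _ => ⟨hV, h⟩⟩
    · exact ⟨∅, 0, 0, fun h => absurd h hc⟩
  choose O B B' hO using key
  obtain ⟨cov, hcov⟩ := exists_chartCover F hΛ O fun c hc => (hO c hc).1
  have hfr : ∀ c ∈ cov.S, IsAdaptedFrame Λ (cov.V c) c Eu Es (B c) (B' c) := fun c hc =>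
    (hO c (hcov c hc).1).2.mono (hcov c hc).2
  have hbd : ∀ c, ∃ D : ℝ, c ∈ cov.S → ∀ y ∈ cov.V c ∩ Λ, ‖B c y‖ ≤ D ∧ ‖B' c y‖ ≤ D ∧
      ∀ v : TangentSpace (𝓡 d) y,
      ‖B' c y (mfderiv (𝓡 d) 𝓘(ℝ, EuclideanSpace ℝ (Fin d)) (extChartAt (𝓡 d) c) y v)‖ ≤
        D * F.norm y v ∧
      F.norm y v ≤ D *
        ‖B' c y (mfderiv (𝓡 d) 𝓘(ℝ, EuclideanSpace ℝ (Fin d)) (extChartAt (𝓡 d) c) y v)‖ := by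
    intro c
    by_cases hc : c ∈ cov.S
    · obtain ⟨D, hD⟩ := (hfr c hc).exists_bound F ((cov.isCompact_V c hc).inter_right hΛ.isClosed)
      exact ⟨D, fun _ => hD⟩
    · exact ⟨0, fun h => absurd h hc⟩
  choose D hD using hbd
  have hle : ∀ c ∈ cov.S, D c ≤ 1 + ∑ c ∈ cov.S, |D c| := fun c hc =>
    ((le_abs_self _).trans (Finset.single_le_sum (f := fun c => |D c|)
      (fun _ _ => abs_nonneg _) hc)).trans (by linarith)
  refine ⟨⟨cov, B, B', 1 + ∑ c ∈ cov.S, |D c|, hfr, ?_, ?_, ?_, ?_, ?_⟩⟩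
  · linarith [Finset.sum_nonneg fun c (_ : c ∈ cov.S) => abs_nonneg (D c)]
  · exact fun c hc y hy => (hD c hc y hy).1.trans (hle c hc)
  · exact fun c hc y hy => (hD c hc y hy).2.1.trans (hle c hc)
  · exact fun c hc y hy v => ((hD c hc y hy).2.2 v).1.trans
      (mul_le_mul_of_nonneg_right (hle c hc) (apply_nonneg _ _))
  · exact fun c hc y hy v => ((hD c hc y hy).2.2 v).2.trans
      (mul_le_mul_of_nonneg_right (hle c hc) (norm_nonneg _))

/-- The map `g` preserves the splitting over `Λ`, and is expanding and contracting in one step, by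
a factor at least `κ`. -/
structure IsOneStepHyperbolic (F : FinslerNorm d M) (Λ : Set M)
    (Eu Es : ∀ x : M, Submodule ℝ (TangentSpace (𝓡 d) x)) (g : M → M) (κ : ℝ) : Prop where
  contMDiff : ContMDiff (𝓡 d) (𝓡 d) 1 g
  mapsTo : MapsTo g Λ Λ
  map_Eu : ∀ x ∈ Λ, ∀ v ∈ Eu x, mfderiv (𝓡 d) (𝓡 d) g x v ∈ Eu (g x)
  map_Es : ∀ x ∈ Λ, ∀ v ∈ Es x, mfderiv (𝓡 d) (𝓡 d) g x v ∈ Es (g x)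
  le_norm : ∀ x ∈ Λ, ∀ v ∈ Eu x, κ * F.norm x v ≤ F.norm (g x) (mfderiv (𝓡 d) (𝓡 d) g x v)
  norm_le : ∀ x ∈ Λ, ∀ v ∈ Es x, κ * F.norm (g x) (mfderiv (𝓡 d) (𝓡 d) g x v) ≤ F.norm x v

variable {F : FinslerNorm d M} {Λ : Set M} {du ds : ℕ}
  {Eu Es : ∀ x : M, Submodule ℝ (TangentSpace (𝓡 d) x)} {g : M → M}

/-- In adapted coordinates, the derivative of `g` is block diagonal and hyperbolic. -/
theorem AdaptedCover.exists_block_derivative (cov : AdaptedCover F Λ du ds Eu Es)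
    (hg : IsOneStepHyperbolic F Λ Eu Es g (4 * cov.D ^ 2)) {c c' y : M} (hc : c ∈ cov.S)
    (hc' : c' ∈ cov.S) (hy : y ∈ Λ) (hyc : y ∈ cov.V c) (hyc' : g y ∈ cov.V c') :
    ∃ (Au : (Fin du → ℝ) →ₗ[ℝ] (Fin du → ℝ)) (As : (Fin ds → ℝ) →ₗ[ℝ] (Fin ds → ℝ))
      (L : EuclideanSpace ℝ (Fin d) →L[ℝ] EuclideanSpace ℝ (Fin d)),
      (∀ a, 4 * ‖a‖ ≤ ‖Au a‖) ∧ (∀ b, ‖As b‖ ≤ ‖b‖ / 4) ∧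
      HasStrictFDerivAt (extChartAt (𝓡 d) c' ∘ g ∘ (extChartAt (𝓡 d) c).symm) L
        (extChartAt (𝓡 d) c y) ∧
      ∀ ξ, cov.B' c' (g y) (L (cov.B c y ξ)) = (Au ξ.1, As ξ.2) := by
  set e := extChartAt (𝓡 d) c
  set e' := extChartAt (𝓡 d) c'
  have hys : y ∈ e.source := cov.V_subset c hc hyc
  have hgys : g y ∈ e'.source := cov.V_subset c' hc' hyc'
  have hgΛ : g y ∈ Λ := hg.mapsTo hy
  have hey : e y ∈ e.target := e.map_source hys
  have hDpos : 0 < cov.D := zero_lt_one.trans_le cov.one_le_D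
  have hsm : ContDiffAt ℝ 1 (e' ∘ g ∘ e.symm) (e y) := by
    rw [← contMDiffAt_iff_contDiffAt]
    have h1 : ContMDiffAt 𝓘(ℝ, EuclideanSpace ℝ (Fin d)) (𝓡 d) 1 e.symm (e y) :=
      (contMDiffOn_extChartAt_symm c _ hey).contMDiffAt ((isOpen_extChartAt_target c).mem_nhds hey)
    have h2 : ContMDiffAt 𝓘(ℝ, EuclideanSpace ℝ (Fin d)) (𝓡 d) 1 (g ∘ e.symm) (e y) :=
      (hg.contMDiff _).comp (e y) h1
    refine ContMDiffAt.comp (e y) (contMDiffAt_extChartAt' ?_) h2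
    simp only [Function.comp, e.left_inv hys]
    simpa [e'] using hgys
  have hstrict := hsm.hasStrictFDerivAt one_ne_zero
  set L := fderiv ℝ (e' ∘ g ∘ e.symm) (e y) with hL
  -- The chain rule identifies the derivative in charts with `mfderiv` of `g`, so that the
  -- hypotheses on the tangent bundle can be transported.
  have hchain : ∀ v : TangentSpace (𝓡 d) y,
      L (mfderiv (𝓡 d) 𝓘(ℝ, EuclideanSpace ℝ (Fin d)) e y v) =
      mfderiv (𝓡 d) 𝓘(ℝ, EuclideanSpace ℝ (Fin d)) e' (g y) (mfderiv (𝓡 d) (𝓡 d) g y v) := by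
    have hed : MDifferentiableAt (𝓡 d) 𝓘(ℝ, EuclideanSpace ℝ (Fin d)) e y :=
      mdifferentiableAt_extChartAt (by simpa [e] using hys)
    have hed' : MDifferentiableAt (𝓡 d) 𝓘(ℝ, EuclideanSpace ℝ (Fin d)) e' (g y) :=
      mdifferentiableAt_extChartAt (by simpa [e'] using hgys)
    have hgd : MDifferentiableAt (𝓡 d) (𝓡 d) g y := (hg.contMDiff y).mdifferentiableAt one_ne_zero
    have hFd : MDifferentiableAt 𝓘(ℝ, EuclideanSpace ℝ (Fin d)) 𝓘(ℝ, EuclideanSpace ℝ (Fin d))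
        (e' ∘ g ∘ e.symm) (e y) := hstrict.hasFDerivAt.differentiableAt.mdifferentiableAt
    have h1 := mfderiv_comp y hFd hed
    have h2 := mfderiv_comp y hed' hgd
    have heq : (e' ∘ g ∘ e.symm) ∘ e =ᶠ[𝓝 y] e' ∘ g := by
      filter_upwards [(isOpen_extChartAt_source c).mem_nhds hys] with z hz
      simp only [Function.comp, e.left_inv hz]
    rw [heq.mfderiv_eq, h2, mfderiv_eq_fderiv] at h1
    intro v
    exact (congrArg (fun T => T v) h1).symm
  have hfr := cov.isAdaptedFrame c hc
  have hfr' := cov.isAdaptedFrame c' hc'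
  have hyV : y ∈ cov.V c ∩ Λ := ⟨hyc, hy⟩
  have hyV' : g y ∈ cov.V c' ∩ Λ := ⟨hyc', hgΛ⟩
  have hlift : ∀ ξ, ∃ v : TangentSpace (𝓡 d) y,
      mfderiv (𝓡 d) 𝓘(ℝ, EuclideanSpace ℝ (Fin d)) e y v = cov.B c y ξ := fun ξ =>
    (isInvertible_mfderiv_extChartAt hys).surjective _
  let H : ((Fin du → ℝ) × (Fin ds → ℝ)) →ₗ[ℝ] ((Fin du → ℝ) × (Fin ds → ℝ)) :=
    (cov.B' c' (g y) ∘L L ∘L cov.B c y).toLinearMap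
  have hH : ∀ ξ, H ξ = cov.B' c' (g y) (L (cov.B c y ξ)) := fun ξ => rfl
  have hu : ∀ a, (H (a, 0)).2 = 0 ∧ 4 * ‖a‖ ≤ ‖H (a, 0)‖ := by
    intro a
    obtain ⟨v, hv⟩ := hlift (a, 0)
    have hcoord := hfr.left_inv y hyV (a, 0)
    rw [← hv] at hcoord
    have hvE : v ∈ Eu y := (hfr.mem_Eu y hyV v).2 (by rw [hcoord])
    have h1 := (hfr'.mem_Eu (g y) hyV' _).1 (hg.map_Eu y hy v hvE)
    have h2 := hg.le_norm y hy v hvE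
    have h3 := cov.norm_coord_le c hc y hyV v
    have h4 := cov.norm_le_coord c' hc' (g y) hyV' (mfderiv (𝓡 d) (𝓡 d) g y v)
    rw [← hchain, hv, ← hH] at h4
    rw [← hchain, hv, ← hH] at h1
    refine ⟨h1, ?_⟩
    rw [hcoord] at h3
    have h5 : ‖((a, 0) : (Fin du → ℝ) × (Fin ds → ℝ))‖ = ‖a‖ := by
      simp [Prod.norm_def]
    rw [h5] at h3
    -- One factor `D` is lost entering the coordinates and one leaving them; the rate `4 * D ^ 2`
    -- leaves exactly 4.
    have h6 : cov.D * (4 * ‖a‖) ≤ cov.D * ‖H (a, 0)‖ := by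
      calc cov.D * (4 * ‖a‖) ≤ cov.D * (4 * (cov.D * F.norm y v)) := by gcongr
        _ = 4 * cov.D ^ 2 * F.norm y v := by ring
        _ ≤ _ := h2.trans h4
    exact le_of_mul_le_mul_left h6 hDpos
  have hs : ∀ b, (H (0, b)).1 = 0 ∧ ‖H (0, b)‖ ≤ ‖b‖ / 4 := by
    intro b
    obtain ⟨v, hv⟩ := hlift (0, b)
    have hcoord := hfr.left_inv y hyV (0, b)
    rw [← hv] at hcoord
    have hvE : v ∈ Es y := (hfr.mem_Es y hyV v).2 (by rw [hcoord])
    have h1 := (hfr'.mem_Es (g y) hyV' _).1 (hg.map_Es y hy v hvE)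
    have h2 := hg.norm_le y hy v hvE
    have h3 := cov.norm_le_coord c hc y hyV v
    have h4 := cov.norm_coord_le c' hc' (g y) hyV' (mfderiv (𝓡 d) (𝓡 d) g y v)
    rw [← hchain, hv, ← hH] at h4
    rw [← hchain, hv, ← hH] at h1
    refine ⟨h1, ?_⟩
    rw [hcoord] at h3
    have h5 : ‖((0, b) : (Fin du → ℝ) × (Fin ds → ℝ))‖ = ‖b‖ := by
      simp [Prod.norm_def]
    rw [h5] at h3
    have h6 : cov.D * (4 * ‖H (0, b)‖) ≤ cov.D * ‖b‖ := by
      calc cov.D * (4 * ‖H (0, b)‖)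
          ≤ cov.D * (4 * (cov.D * F.norm (g y) (mfderiv (𝓡 d) (𝓡 d) g y v))) := by gcongr
        _ = 4 * cov.D ^ 2 * F.norm (g y) (mfderiv (𝓡 d) (𝓡 d) g y v) := by ring
        _ ≤ _ := h2.trans h3
    have := le_of_mul_le_mul_left h6 hDpos
    linarith
  -- `Au` and `As` are the diagonal blocks of `H`; invariance of the splitting kills the
  -- off-diagonal ones.
  refine ⟨LinearMap.fst ℝ _ _ ∘ₗ H ∘ₗ LinearMap.inl ℝ _ _,
    LinearMap.snd ℝ _ _ ∘ₗ H ∘ₗ LinearMap.inr ℝ _ _, L, ?_, ?_, hstrict, ?_⟩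
  · intro a
    refine (hu a).2.trans ?_
    rw [Prod.norm_def, (hu a).1, norm_zero]
    exact max_le le_rfl (norm_nonneg _)
  · intro b
    exact (norm_snd_le (H (0, b))).trans (hs b).2
  · intro ξ
    rw [← hH]
    have h1 : ξ = (ξ.1, 0) + (0, ξ.2) := by simp
    rw [h1, map_add]
    refine Prod.ext ?_ ?_
    · simp only [Prod.fst_add, (hs ξ.2).1, add_zero]
      rfl
    · simp only [Prod.snd_add, (hu ξ.1).1, zero_add]
      rfl

end Shadowing

/-! ### Shadowing of closed pseudo-orbits with summable error -/

section PseudoOrbits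

variable {d : ℕ} {M : Type*} [TopologicalSpace M]
  [ChartedSpace (EuclideanSpace ℝ (Fin d)) M] [IsManifold (𝓡 d) 1 M]
  {F : FinslerNorm d M} {Λ : Set M} {du ds : ℕ}
  {Eu Es : ∀ x : M, Submodule ℝ (TangentSpace (𝓡 d) x)} {g : M → M}

/-- At scale `δ` around `x` and `x'`, the map `g` in the charts centred at `c` and `c'` is close to
a hyperbolic block diagonal map. -/
def AdaptedCover.IsNearHyperbolicAt (cov : AdaptedCover F Λ du ds Eu Es) (g : M → M) (O : Set M)
    (c c' : M) (δ : ℝ) (x x' : M) : Prop :=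
  x ∈ cov.V c → x' ∈ cov.V c' →
  ∃ (Au : (Fin du → ℝ) →ₗ[ℝ] (Fin du → ℝ)) (As : (Fin ds → ℝ) →ₗ[ℝ] (Fin ds → ℝ)),
    (∀ a, 4 * ‖a‖ ≤ ‖Au a‖) ∧ (∀ b, ‖As b‖ ≤ ‖b‖ / 4) ∧
    ∀ b ∈ cov.V c ∩ Λ, ∀ b' ∈ cov.V c' ∩ Λ,
      dist (extChartAt (𝓡 d) c b) (extChartAt (𝓡 d) c x) < δ →
      dist (extChartAt (𝓡 d) c' b') (extChartAt (𝓡 d) c' x') < δ →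
      ∀ z w, dist z (extChartAt (𝓡 d) c x) ≤ δ → dist w (extChartAt (𝓡 d) c x) ≤ δ →
        z ∈ (extChartAt (𝓡 d) c).target ∧ (extChartAt (𝓡 d) c).symm z ∈ O ∧
        g ((extChartAt (𝓡 d) c).symm z) ∈ (extChartAt (𝓡 d) c').source ∧
        dist (cov.Θ ((extChartAt (𝓡 d) c).symm z)) (cov.Θ ((extChartAt (𝓡 d) c).symm w)) ≤
          δ⁻¹ * dist z w ∧
        ‖cov.B' c' b' (extChartAt (𝓡 d) c' (g ((extChartAt (𝓡 d) c).symm z)) -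
            extChartAt (𝓡 d) c' (g ((extChartAt (𝓡 d) c).symm w))) -
          (Au (cov.B' c b (z - w)).1, As (cov.B' c b (z - w)).2)‖ ≤ ‖cov.B' c b (z - w)‖ / 4

/-- A smaller scale restricts the points and weakens the Lipschitz bound `δ⁻¹`. This monotonicity is
what makes the property uniform by compactness. -/
theorem AdaptedCover.IsNearHyperbolicAt.mono {cov : AdaptedCover F Λ du ds Eu Es} {O : Set M}
    {c c' x x' : M} {δ δ' : ℝ} (h : cov.IsNearHyperbolicAt g O c c' δ x x') (hδ' : 0 < δ')
    (hle : δ' ≤ δ) : cov.IsNearHyperbolicAt g O c c' δ' x x' := by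
  intro hx hx'
  obtain ⟨Au, As, hAu, hAs, H⟩ := h hx hx'
  refine ⟨Au, As, hAu, hAs, fun b hb b' hb' h1 h2 z w hz hw => ?_⟩
  obtain ⟨k1, k2, k3, k4, k5⟩ := H b hb b' hb' (h1.trans_le hle) (h2.trans_le hle) z w
    (hz.trans hle) (hw.trans hle)
  exact ⟨k1, k2, k3, k4.trans (mul_le_mul_of_nonneg_right (inv_anti₀ hδ' hle) dist_nonneg), k5⟩

/-- Strict differentiability at `y` controls differences of values of `g` at nearby points by the
block derivative at `y`. The splitting exists on `Λ` only, so points off `Λ` borrow the frame of a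
nearby point of `Λ`; continuity of the frames makes this harmless. -/
theorem AdaptedCover.eventually_isNearHyperbolicAt [T2Space M]
    (cov : AdaptedCover F Λ du ds Eu Es)
    (hg : IsOneStepHyperbolic F Λ Eu Es g (4 * cov.D ^ 2)) {O : Set M} (hO : IsOpen O)
    (hΛO : Λ ⊆ O) {c c' y : M} (hc : c ∈ cov.S) (hc' : c' ∈ cov.S) (hy : y ∈ Λ) :
    ∃ δ > 0, ∀ᶠ p in 𝓝 (y, g y), cov.IsNearHyperbolicAt g O c c' δ p.1 p.2 := by
  by_cases hyc : y ∈ cov.V c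
  swap
  -- The piece is closed, so points near `y` miss it too and the property is vacuous.
  · refine ⟨1, one_pos, ?_⟩
    filter_upwards [continuousAt_fst.preimage_mem_nhds
      ((cov.isCompact_V c hc).isClosed.isOpen_compl.mem_nhds hyc)] with p hp h
    exact absurd h hp
  by_cases hyc' : g y ∈ cov.V c'
  swap
  · refine ⟨1, one_pos, ?_⟩
    filter_upwards [continuousAt_snd.preimage_mem_nhds
      ((cov.isCompact_V c' hc').isClosed.isOpen_compl.mem_nhds hyc')] with p hp _ h
    exact absurd h hp
  obtain ⟨Au, As, L, hAu, hAs, hstrict, hblock⟩ :=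
    cov.exists_block_derivative hg hc hc' hy hyc hyc'
  set e := extChartAt (𝓡 d) c
  set e' := extChartAt (𝓡 d) c'
  have hys : y ∈ e.source := cov.V_subset c hc hyc
  have hgys : g y ∈ e'.source := cov.V_subset c' hc' hyc'
  have hey : e y ∈ e.target := e.map_source hys
  have hey' : e' (g y) ∈ e'.target := e'.map_source hgys
  have hgcont : Continuous g := hg.contMDiff.continuous
  have hyV : y ∈ cov.V c ∩ Λ := ⟨hyc, hy⟩
  have hyV' : g y ∈ cov.V c' ∩ Λ := ⟨hyc', hg.mapsTo hy⟩
  set D := cov.D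
  have hD : 0 < D := zero_lt_one.trans_le cov.one_le_D
  let H := cov.B' c' (g y) ∘L L ∘L cov.B c y
  obtain ⟨s, hs, happ⟩ := hstrict.approximates_deriv_on_nhds (c := ⟨1 / (8 * D ^ 2), by positivity⟩)
    (Or.inr (NNReal.coe_pos.1 (show (0 : ℝ) < 1 / (8 * D ^ 2) by positivity)))
  obtain ⟨A, W, hW, hA⟩ := cov.contMDiff.exists_dist_le_extChartAt hys
  obtain ⟨N₁, hN₁, hB₁⟩ : ∃ N ∈ 𝓝 y, ∀ b ∈ N ∩ (cov.V c ∩ Λ),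
      ‖H‖ * ‖cov.B' c y - cov.B' c b‖ ≤ 1 / (16 * D) := by
    have h1 : ContinuousWithinAt (fun b => ‖H‖ * ‖cov.B' c y - cov.B' c b‖) (cov.V c ∩ Λ) y :=
      continuousWithinAt_const.mul
        (continuousWithinAt_const.sub ((cov.isAdaptedFrame c hc).continuousOn' y hyV)).norm
    have h2 := h1.tendsto.eventually_lt_const (u := 1 / (16 * D)) (by
      rw [sub_self, norm_zero, mul_zero]
      positivity)
    obtain ⟨N, hN, h3⟩ := mem_nhdsWithin_iff_exists_mem_nhds_inter.1 h2
    exact ⟨N, hN, fun b hb => (h3 hb).le⟩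
  obtain ⟨N₂, hN₂, hB₂⟩ : ∃ N ∈ 𝓝 (g y), ∀ b ∈ N ∩ (cov.V c' ∩ Λ),
      ‖cov.B' c' b - cov.B' c' (g y)‖ * ‖L‖ ≤ 1 / (16 * D) := by
    have h1 : ContinuousWithinAt (fun b => ‖cov.B' c' b - cov.B' c' (g y)‖ * ‖L‖)
        (cov.V c' ∩ Λ) (g y) :=
      (((cov.isAdaptedFrame c' hc').continuousOn' (g y) hyV').sub
        continuousWithinAt_const).norm.mul continuousWithinAt_const
    have h2 := h1.tendsto.eventually_lt_const (u := 1 / (16 * D)) (by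
      rw [sub_self, norm_zero, zero_mul]
      positivity)
    obtain ⟨N, hN, h3⟩ := mem_nhdsWithin_iff_exists_mem_nhds_inter.1 h2
    exact ⟨N, hN, fun b hb => (h3 hb).le⟩
  obtain ⟨r, hr, hball⟩ : ∃ r > 0, Metric.ball (e y) r ⊆
      (e.target ∩ e.symm ⁻¹' (O ∩ W ∩ N₁ ∩ g ⁻¹' e'.source)) ∩ s := by
    refine Metric.mem_nhds_iff.1 (Filter.inter_mem (Filter.inter_mem
      ((isOpen_extChartAt_target c).mem_nhds hey) ?_) hs)
    refine (continuousAt_extChartAt_symm'' hey).preimage_mem_nhds ?_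
    rw [e.left_inv hys]
    exact Filter.inter_mem (Filter.inter_mem (Filter.inter_mem (hO.mem_nhds (hΛO hy)) hW) hN₁)
      (hgcont.continuousAt.preimage_mem_nhds ((isOpen_extChartAt_source c').mem_nhds hgys))
  obtain ⟨r', hr', hball'⟩ : ∃ r > 0, Metric.ball (e' (g y)) r ⊆ e'.symm ⁻¹' N₂ := by
    refine Metric.mem_nhds_iff.1 ((continuousAt_extChartAt_symm'' hey').preimage_mem_nhds ?_)
    rwa [e'.left_inv hgys]
  set δ := min (min (r / 2) (r' / 2)) (1 / (|A| + 1)) with hδ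
  have hδ0 : 0 < δ := by positivity
  have hδr : δ ≤ r / 2 := (min_le_left _ _).trans (min_le_left _ _)
  have hδr' : δ ≤ r' / 2 := (min_le_left _ _).trans (min_le_right _ _)
  have hδA : A ≤ δ⁻¹ := by
    have h1 : (1 / (|A| + 1))⁻¹ ≤ δ⁻¹ := inv_anti₀ hδ0 (min_le_right _ _)
    rw [one_div, inv_inv] at h1
    linarith [le_abs_self A]
  refine ⟨δ, hδ0, ?_⟩
  have hnx : ∀ᶠ p : M × M in 𝓝 (y, g y), p.1 ∈ e ⁻¹' Metric.ball (e y) (r / 2) :=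
    continuousAt_fst.preimage_mem_nhds
      ((continuousAt_extChartAt' hys).preimage_mem_nhds (Metric.ball_mem_nhds _ (by positivity)))
  have hnx' : ∀ᶠ p : M × M in 𝓝 (y, g y), p.2 ∈ e' ⁻¹' Metric.ball (e' (g y)) (r' / 2) :=
    continuousAt_snd.preimage_mem_nhds
      ((continuousAt_extChartAt' hgys).preimage_mem_nhds (Metric.ball_mem_nhds _ (by positivity)))
  filter_upwards [hnx, hnx'] with p hp hp' _ _
  have hp1 : dist (e p.1) (e y) < r / 2 := hp
  have hp2 : dist (e' p.2) (e' (g y)) < r' / 2 := hp'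
  refine ⟨Au, As, hAu, hAs, fun b hb b' hb' h1 h2 z w hz hw => ?_⟩
  have near : ∀ z, dist z (e p.1) ≤ δ → z ∈ Metric.ball (e y) r := fun z hz => by
    have := dist_triangle z (e p.1) (e y)
    rw [Metric.mem_ball]
    linarith
  obtain ⟨⟨hzt, ⟨⟨hzO, hzW⟩, -⟩, hzg⟩, hzs⟩ := hball (near z hz)
  obtain ⟨⟨-, ⟨⟨-, hwW⟩, -⟩, -⟩, hws⟩ := hball (near w hw)
  have hwt : w ∈ e.target := (hball (near w hw)).1.1
  have hbN : b ∈ N₁ := by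
    have := (hball (near (e b) h1.le)).1.2.1.2
    rwa [e.left_inv (cov.V_subset c hc hb.1)] at this
  have hbN' : b' ∈ N₂ := by
    have h3 : e' b' ∈ Metric.ball (e' (g y)) r' := by
      have := dist_triangle (e' b') (e' p.2) (e' (g y))
      rw [Metric.mem_ball]
      linarith
    have := hball' h3
    rwa [mem_preimage, e'.left_inv (cov.V_subset c' hc' hb'.1)] at this
  refine ⟨hzt, hzO, hzg, ?_, ?_⟩
  · have := hA _ hzW _ hwW
    rw [e.right_inv hzt, e.right_inv hwt] at this
    exact this.trans (mul_le_mul_of_nonneg_right hδA dist_nonneg)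
  · set ξ := cov.B' c b (z - w) with hξ
    have hzw : ‖z - w‖ ≤ D * ‖ξ‖ := by
      have := (cov.B c b).le_of_opNorm_le (cov.norm_B_le c hc b hb) ξ
      rwa [hξ, (cov.isAdaptedFrame c hc).right_inv b hb] at this
    set Fz := e' (g (e.symm z))
    set Fw := e' (g (e.symm w))
    have k1 : ‖Fz - Fw - L (z - w)‖ ≤ 1 / (8 * D ^ 2) * ‖z - w‖ :=
      happ z hzs w hws
    have k2 : (Au ξ.1, As ξ.2) = H ξ := (hblock ξ).symm
    have k3 : H (cov.B' c y (z - w)) = cov.B' c' (g y) (L (z - w)) := by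
      change cov.B' c' (g y) (L (cov.B c y (cov.B' c y (z - w)))) = _
      rw [(cov.isAdaptedFrame c hc).right_inv y hyV]
    -- Three errors: nonlinearity of `g`, change of frame at the target, change of frame at the
    -- source. In units of `‖z - w‖ / D` they are at most `1/8`, `1/16` and `1/16`, and `‖z - w‖ ≤ D
    -- * ‖ξ‖`, which yields the required `1/4`.
    have k4 : cov.B' c' b' (Fz - Fw) - (Au ξ.1, As ξ.2) =
        cov.B' c' b' (Fz - Fw - L (z - w)) +
        ((cov.B' c' b' - cov.B' c' (g y)) (L (z - w)) +
          H ((cov.B' c y - cov.B' c b) (z - w))) := by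
      rw [k2, sub_apply, sub_apply, map_sub H, k3,
        map_sub (cov.B' c' b') (Fz - Fw)]
      abel
    have b1 : ‖cov.B' c' b' (Fz - Fw - L (z - w))‖ ≤ D * (1 / (8 * D ^ 2) * ‖z - w‖) :=
      ((cov.B' c' b').le_of_opNorm_le (cov.norm_B'_le c' hc' b' hb') _).trans
        (mul_le_mul_of_nonneg_left k1 hD.le)
    have b2 : ‖(cov.B' c' b' - cov.B' c' (g y)) (L (z - w))‖ ≤ 1 / (16 * D) * ‖z - w‖ := by
      refine (ContinuousLinearMap.le_opNorm _ _).trans ?_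
      refine (mul_le_mul_of_nonneg_left (L.le_opNorm _) (norm_nonneg _)).trans ?_
      rw [← mul_assoc]
      exact mul_le_mul_of_nonneg_right (hB₂ b' ⟨hbN', hb'⟩) (norm_nonneg _)
    have b3 : ‖H ((cov.B' c y - cov.B' c b) (z - w))‖ ≤ 1 / (16 * D) * ‖z - w‖ := by
      refine (ContinuousLinearMap.le_opNorm _ _).trans ?_
      refine (mul_le_mul_of_nonneg_left (ContinuousLinearMap.le_opNorm _ _)
        (norm_nonneg _)).trans ?_
      rw [← mul_assoc]
      exact mul_le_mul_of_nonneg_right (hB₁ b ⟨hbN, hb⟩) (norm_nonneg _)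
    rw [k4]
    calc _ ≤ D * (1 / (8 * D ^ 2) * ‖z - w‖) +
          (1 / (16 * D) * ‖z - w‖ + 1 / (16 * D) * ‖z - w‖) :=
          (norm_add_le _ _).trans (add_le_add b1 ((norm_add_le _ _).trans (add_le_add b2 b3)))
      _ = 1 / (4 * D) * ‖z - w‖ := by field_simp; ring
      _ ≤ 1 / (4 * D) * (D * ‖ξ‖) := by gcongr
      _ = ‖ξ‖ / 4 := by field_simp

/-- Shadowing of closed pseudo-orbits of a hyperbolic map, with a bound for the sum of the
distances. -/
theorem AdaptedCover.exists_shadowing [T2Space M] (cov : AdaptedCover F Λ du ds Eu Es)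
    (hΛ : IsCompact Λ) (hg : IsOneStepHyperbolic F Λ Eu Es g (4 * cov.D ^ 2)) {O : Set M}
    (hO : IsOpen O) (hΛO : Λ ⊆ O) :
    ∃ δ > 0, ∃ K : ℝ, 0 ≤ K ∧ ∃ Ω : Set M, IsOpen Ω ∧ Λ ⊆ Ω ∧
      ∀ (ι : Type) [Fintype ι] (θ : Equiv.Perm ι) (x : ι → M), (∀ i, x i ∈ Ω) →
        (∀ i, dist (cov.Θ (g (x i))) (cov.Θ (x (θ i))) < δ) →
        ∃ p : ι → M, (∀ i, g (p i) = p (θ i)) ∧ (∀ i, p i ∈ O) ∧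
          ∑ i, dist (cov.Θ (p i)) (cov.Θ (x i)) ≤
            K * ∑ i, dist (cov.Θ (g (x i))) (cov.Θ (x (θ i))) := by
  have hgcont : Continuous g := hg.contMDiff.continuous
  have hΘ := cov.contMDiff.continuous
  -- The scale is written `t⁻¹`, so that the property is monotone in `t`. Pairs with `g a ≠ b` are
  -- handled by a scale below the size of the jump, where the property is vacuous.
  obtain ⟨t, Ω₁, hΩ₁, hΛΩ₁, hP⟩ := exists_isOpen_of_eventually_prod hΛ
    (fun t x x' => 0 < t ∧ (dist (cov.Θ (g x)) (cov.Θ x') < t⁻¹ →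
      ∀ c ∈ cov.S, ∀ c' ∈ cov.S, cov.IsNearHyperbolicAt g O c c' t⁻¹ x x'))
    (by
      rintro s t x y hst ⟨hs, h⟩
      have ht := hs.trans_le hst
      have hinv := inv_anti₀ hs hst
      exact ⟨ht, fun hd c hc c' hc' =>
        (h (hd.trans_le hinv) c hc c' hc').mono (inv_pos.2 ht) hinv⟩)
    (by
      intro a ha b hb
      by_cases hab : g a = b
      · subst hab
        have h1 : ∀ q : cov.S × cov.S, ∃ δ > 0, ∀ᶠ p in 𝓝 (a, g a),
            cov.IsNearHyperbolicAt g O q.1 q.2 δ p.1 p.2 := fun q =>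
          cov.eventually_isNearHyperbolicAt hg hO hΛO q.1.2 q.2.2 ha
        choose δ hδ hev using h1
        have hsum : 0 ≤ ∑ q, (δ q)⁻¹ := Finset.sum_nonneg fun q _ => (inv_pos.2 (hδ q)).le
        refine ⟨1 + ∑ q, (δ q)⁻¹, ?_⟩
        filter_upwards [Filter.eventually_all.2 hev] with p hp
        refine ⟨by positivity, fun _ c hc c' hc' => ?_⟩
        refine (hp (⟨c, hc⟩, ⟨c', hc'⟩)).mono (by positivity) ?_
        rw [inv_le_comm₀ (by positivity) (hδ _)]
        have := Finset.single_le_sum (f := fun q => (δ q)⁻¹)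
          (fun q _ => (inv_pos.2 (hδ q)).le) (Finset.mem_univ (⟨c, hc⟩, ⟨c', hc'⟩))
        linarith
      · have hpos : 0 < dist (cov.Θ (g a)) (cov.Θ b) :=
          lt_of_le_of_ne dist_nonneg fun h0 =>
            hab (cov.eq_of_dist_eq_zero (hg.mapsTo ha) h0.symm)
        refine ⟨(dist (cov.Θ (g a)) (cov.Θ b) / 2)⁻¹, ?_⟩
        have h1 : Continuous fun p : M × M => dist (cov.Θ (g p.1)) (cov.Θ p.2) := by fun_prop
        have h2 : ∀ᶠ p : M × M in 𝓝 (a, b),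
            dist (cov.Θ (g a)) (cov.Θ b) / 2 < dist (cov.Θ (g p.1)) (cov.Θ p.2) :=
          (h1.tendsto (a, b)).eventually_const_lt (by simpa using hpos)
        filter_upwards [h2] with p hp
        refine ⟨by positivity, fun h => ?_⟩
        rw [inv_inv] at h
        exact absurd h hp.le.not_gt)
  -- Positivity of `t` is part of the uniform property, and reading it off requires a point of `Λ`.
  rcases Λ.eq_empty_or_nonempty with rfl | ⟨y₀, hy₀⟩
  · refine ⟨1, one_pos, 0, le_rfl, ∅, isOpen_empty, Subset.rfl, fun ι _ θ x hx _ => ?_⟩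
    exact ⟨x, fun i => (hx i).elim, fun i => (hx i).elim, by
      simp only [dist_self, Finset.sum_const_zero, zero_mul, le_refl]⟩
  have ht : 0 < t := (hP y₀ (hΛΩ₁ hy₀) y₀ (hΛΩ₁ hy₀)).1
  have ht' : 0 < t⁻¹ := inv_pos.2 ht
  let Q : Set M := {x | ∃ c ∈ cov.S, ∃ b ∈ cov.V c ∩ Λ, x ∈ cov.V c ∧
    dist (extChartAt (𝓡 d) c b) (extChartAt (𝓡 d) c x) < t⁻¹}
  have hΛQ : Λ ⊆ interior Q := by
    intro y hy
    rw [mem_interior_iff_mem_nhds]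
    obtain ⟨c, hc, hyc⟩ := cov.exists_mem_nhds y hy
    have hyV := mem_of_mem_nhds hyc
    have h1 : ∀ᶠ x in 𝓝 y, extChartAt (𝓡 d) c x ∈ Metric.ball (extChartAt (𝓡 d) c y) t⁻¹ :=
      (continuousAt_extChartAt' (cov.V_subset c hc hyV)).preimage_mem_nhds
        (Metric.ball_mem_nhds _ ht')
    filter_upwards [hyc, h1] with x hx hx'
    refine ⟨c, hc, y, ⟨hyV, hy⟩, hx, ?_⟩
    rw [dist_comm]
    exact hx'
  set D := cov.D
  have hD : 0 < D := zero_lt_one.trans_le cov.one_le_D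
  have hK := cov.K_nonneg
  -- Coordinates of norm at most `r` move a point of the chart by at most `t⁻¹`.
  set r := t⁻¹ / D with hr
  have hr0 : 0 < r := by positivity
  -- The three terms allow comparison of charts through `Θ`, the use of `hP`, and the smallness `‖G
  -- i 0‖ ≤ r / 2` needed by the abstract lemma.
  set δ := min (min (1 / 2) t⁻¹) (r / 2 / (D * cov.K + 1)) with hδdef
  have hδ0 : 0 < δ := by positivity
  refine ⟨δ, hδ0, t * D * (7 * (D * cov.K)), by positivity, Ω₁ ∩ interior Q,
    hΩ₁.inter isOpen_interior, subset_inter hΛΩ₁ hΛQ, ?_⟩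
  intro ι _ θ x hx hjump
  have hQ : ∀ i, x i ∈ Q := fun i => interior_subset (hx i).2
  choose c hc b hb hxV hbx using hQ
  have hhalf : ∀ i, dist (cov.Θ (x (θ i))) (cov.Θ (g (x i))) < 1 / 2 := fun i => by
    rw [dist_comm]
    exact (hjump i).trans_le ((min_le_left _ _).trans (min_le_left _ _))
  have hloc := fun i => (hP (x i) (hx i).1 (x (θ i)) (hx (θ i)).1).2
    ((hjump i).trans_le ((min_le_left _ _).trans (min_le_right _ _))) (c i) (hc i) (c (θ i))
    (hc (θ i)) (hxV i) (hxV (θ i))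
  choose Au As hAu hAs hnear using hloc
  set e : ∀ i, _ := fun i => extChartAt (𝓡 d) (c i) with he
  have hpt : ∀ i (v : (Fin du → ℝ) × (Fin ds → ℝ)), ‖v‖ ≤ r →
      dist (e i (x i) + cov.B (c i) (b i) v) (e i (x i)) ≤ t⁻¹ := by
    intro i v hv
    rw [dist_eq_norm, add_sub_cancel_left]
    refine ((cov.B (c i) (b i)).le_of_opNorm_le (cov.norm_B_le _ (hc i) _ (hb i)) v).trans ?_
    calc D * ‖v‖ ≤ D * r := by gcongr
      _ = t⁻¹ := by rw [hr]; field_simp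
  have hn := fun i (v w : (Fin du → ℝ) × (Fin ds → ℝ)) (hv : ‖v‖ ≤ r) (hw : ‖w‖ ≤ r) =>
    hnear i (b i) (hb i) (b (θ i)) (hb (θ i)) (hbx i) (hbx (θ i)) _ _ (hpt i v hv) (hpt i w hw)
  -- `G i` is `g` in coordinates centred at the pseudo-orbit: at `x i` in the source, at `x (θ i)`
  -- in the target. Its value at 0 is therefore the jump.
  let G : ι → (Fin du → ℝ) × (Fin ds → ℝ) → (Fin du → ℝ) × (Fin ds → ℝ) := fun i v =>
    cov.B' (c (θ i)) (b (θ i)) (e (θ i) (g ((e i).symm (e i (x i) + cov.B (c i) (b i) v))) -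
      e (θ i) (x (θ i)))
  have hxs : ∀ i, x i ∈ (e i).source := fun i => cov.V_subset _ (hc i) (hxV i)
  have hG0 : ∀ i, ‖G i 0‖ ≤ D * cov.K * dist (cov.Θ (g (x i))) (cov.Θ (x (θ i))) := by
    intro i
    simp only [G, map_zero, add_zero, (e i).left_inv (hxs i)]
    refine ((cov.B' _ _).le_of_opNorm_le (cov.norm_B'_le _ (hc (θ i)) _ (hb (θ i))) _).trans ?_
    rw [mul_assoc, ← dist_eq_norm, dist_comm, dist_comm (cov.Θ (g (x i)))]
    exact mul_le_mul_of_nonneg_left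
      (cov.dist_extChartAt_le _ (hc (θ i)) _ (hxV (θ i)) _ (hhalf i)) hD.le
  obtain ⟨v, hv, hGv, hsum⟩ := exists_orbit_of_near_hyperbolic θ Au As hAu hAs G hr0
    (by
      intro i v w hv hw
      have h1 := (hn i v w hv hw).2.2.2.2
      have h2 : cov.B' (c i) (b i) (e i (x i) + cov.B (c i) (b i) v -
          (e i (x i) + cov.B (c i) (b i) w)) = v - w := by
        rw [add_sub_add_left_eq_sub, ← map_sub,
          (cov.isAdaptedFrame _ (hc i)).left_inv _ (hb i)]
      rw [h2] at h1
      refine le_trans (le_of_eq ?_) h1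
      simp only [G]
      rw [← map_sub, sub_sub_sub_cancel_right])
    (by
      intro i
      refine (hG0 i).trans ?_
      have h1 : dist (cov.Θ (g (x i))) (cov.Θ (x (θ i))) ≤ r / 2 / (D * cov.K + 1) :=
        (hjump i).le.trans (min_le_right _ _)
      rw [le_div_iff₀ (by positivity)] at h1
      have h2 : 0 ≤ dist (cov.Θ (g (x i))) (cov.Θ (x (θ i))) := dist_nonneg
      linarith)
  have h0r : ‖(0 : (Fin du → ℝ) × (Fin ds → ℝ))‖ ≤ r := by
    rw [norm_zero]
    exact hr0.le
  refine ⟨fun i => (e i).symm (e i (x i) + cov.B (c i) (b i) (v i)), ?_,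
    fun i => (hn i _ _ (hv i) h0r).2.1, ?_⟩
  · intro i
    have h1 := congrArg (cov.B (c (θ i)) (b (θ i))) (hGv i)
    simp only [G] at h1
    rw [(cov.isAdaptedFrame _ (hc (θ i))).right_inv _ (hb (θ i)), sub_eq_iff_eq_add'] at h1
    beta_reduce
    rw [← h1]
    exact ((e (θ i)).left_inv (hn i _ _ (hv i) h0r).2.2.1).symm
  · have h1 : ∀ i, dist (cov.Θ ((e i).symm (e i (x i) + cov.B (c i) (b i) (v i))))
        (cov.Θ (x i)) ≤ t * (D * ‖v i‖) := by
      intro i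
      have h2 := (hn i _ _ (hv i) h0r).2.2.2.1
      rw [map_zero, add_zero, inv_inv] at h2
      rw [(e i).left_inv (hxs i)] at h2
      refine h2.trans (mul_le_mul_of_nonneg_left ?_ ht.le)
      rw [dist_eq_norm, add_sub_cancel_left]
      exact (cov.B (c i) (b i)).le_of_opNorm_le (cov.norm_B_le _ (hc i) _ (hb i)) _
    calc _ ≤ ∑ i, t * (D * ‖v i‖) := Finset.sum_le_sum fun i _ => h1 i
      _ = t * D * ∑ i, ‖v i‖ := by simp only [Finset.mul_sum, mul_assoc]
      _ ≤ t * D * (7 * ∑ i, D * cov.K * dist (cov.Θ (g (x i))) (cov.Θ (x (θ i)))) := by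
        have h3 := hsum.trans (mul_le_mul_of_nonneg_left
          (Finset.sum_le_sum fun i _ => hG0 i) (by norm_num : (0 : ℝ) ≤ 7))
        exact mul_le_mul_of_nonneg_left h3 (by positivity)
      _ = _ := by rw [← Finset.mul_sum]; ring

end PseudoOrbits

/-! ### From shadowing an iterate to sums along closed chains of `f` -/

section OrbitSums

theorem sum_range_mul_eq {α : Type*} [AddCommMonoid α] (a : ℕ → α) (N m : ℕ) :
    ∑ k ∈ Finset.range (N * m), a k =
      ∑ q ∈ Finset.range m, ∑ l ∈ Finset.range N, a (N * q + l) := by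
  induction m with
  | zero => simp
  | succ m ih => rw [Nat.mul_succ, Finset.sum_range_add, ih, Finset.sum_range_succ]

variable {M Y : Type*} [PseudoMetricSpace Y]

/-- Comparison of a pseudo-orbit with true orbit segments of bounded length. -/
theorem dist_iterate_le_sum (Θ : M → Y) (f : M → M) {Ω₁ : Set M} {N : ℕ} {K : ℝ}
    (hlip : ∀ l ≤ N, ∀ x ∈ Ω₁, ∀ y ∈ Ω₁, dist (Θ (f^[l] x)) (Θ (f^[l] y)) ≤ K * dist (Θ x) (Θ y))
    {ι : Type*} (τ : Equiv.Perm ι) (x : ι → M) (hx : ∀ i, x i ∈ Ω₁) (hfx : ∀ i, f (x i) ∈ Ω₁)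
    {l : ℕ} (hl : l ≤ N) (i : ι) :
    dist (Θ (f^[l] (x i))) (Θ (x ((τ ^ l) i))) ≤
      ∑ m ∈ Finset.range l, K * dist (Θ (f (x ((τ ^ m) i)))) (Θ (x (τ ((τ ^ m) i)))) := by
  induction l generalizing i with
  | zero => simp
  | succ l ih =>
    rw [Finset.sum_range_succ', Function.iterate_succ_apply]
    -- The first jump is carried along by `f^[l]`; the remaining ones are treated by induction from
    -- `τ i`.
    have h1 := hlip l (by omega) _ (hfx i) _ (hx (τ i))
    have h2 := ih (by omega) (τ i)
    have h3 : ∀ m : ℕ, (τ ^ m) (τ i) = (τ ^ (m + 1)) i := fun m => by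
      rw [pow_succ, Equiv.Perm.mul_apply]
    simp only [h3] at h2
    have h4 := dist_triangle (Θ (f^[l] (f (x i)))) (Θ (f^[l] (x (τ i)))) (Θ (x ((τ ^ (l + 1)) i)))
    simp only [pow_zero, Equiv.Perm.one_apply]
    linarith

/-- Points whose orbits under an iterate of `f` form finitely many cycles in a locally maximal
isolating set are periodic points of the maximal invariant set. -/
theorem mem_of_cyclic_orbits (f : M → M) {Λ A : Set M}
    (hmax : (⋂ n : ℕ, f^[n] '' A) ∩ (⋂ n : ℕ, f^[n] ⁻¹' A) = Λ) {N : ℕ} (hN : 0 < N)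
    {ι : Type*} (θ : Equiv.Perm ι) (p : ι → M) (hp : ∀ i, f^[N] (p i) = p (θ i))
    (hA : ∀ i, ∀ l < N, f^[l] (p i) ∈ A) {m : ℕ} (hm : 0 < m) (hθ : θ ^ m = 1) (i : ι) :
    (∀ q l, f^[N * q + l] (p i) = f^[l] (p ((θ ^ q) i))) ∧ f^[N * m] (p i) = p i ∧ p i ∈ Λ := by
  have h1 : ∀ q i, f^[N * q] (p i) = p ((θ ^ q) i) := by
    intro q
    induction q with
    | zero => simp
    | succ q ih =>
      intro i
      rw [Nat.mul_succ, Function.iterate_add_apply, hp, ih, pow_succ, Equiv.Perm.mul_apply]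
  have h2 : ∀ i q l, f^[N * q + l] (p i) = f^[l] (p ((θ ^ q) i)) := fun i q l => by
    rw [add_comm, Function.iterate_add_apply, h1]
  have h3 : ∀ i n, f^[n] (p i) ∈ A := by
    intro i n
    rw [← Nat.div_add_mod n N, h2]
    exact hA _ _ (Nat.mod_lt _ hN)
  have h4 : ∀ n, f^[N * (m * n)] (p i) = p i := fun n => by
    rw [h1, pow_mul, hθ, one_pow, Equiv.Perm.one_apply]
  refine ⟨h2 i, by simpa using h4 1, ?_⟩
  rw [← hmax]
  -- Going around the cycle enough times supplies an `n`-th preimage of `p i` with its orbit in `A`,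
  -- so no inverse of `f` is needed.
  refine ⟨mem_iInter.2 fun n => ⟨f^[N * (m * n) - n] (p i), h3 _ _, ?_⟩,
    mem_iInter.2 fun n => h3 i n⟩
  rw [← Function.iterate_add_apply, Nat.add_sub_cancel', h4]
  calc n = 1 * (1 * n) := by ring
    _ ≤ N * (m * n) := Nat.mul_le_mul hN (Nat.mul_le_mul_right _ hm)

/-- Closed pseudo-orbits with small jumps have non-negative penalized sums, provided iterates of
pseudo-orbits are shadowed by periodic orbits with summable error. -/
theorem exists_closed_chain_sum_nonneg (Θ : M → Y) (f : M → M) (φ : M → ℝ)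
    {Λ A Ω₁ Ω₂ Ω₃ O : Set M} {N : ℕ} (hN : 0 < N) {K K₃ δ₃ : ℝ} (hK : 0 ≤ K) (hK₃ : 0 ≤ K₃)
    (hδ₃ : 0 < δ₃)
    (hlip : ∀ l ≤ N, ∀ x ∈ Ω₁, ∀ y ∈ Ω₁, dist (Θ (f^[l] x)) (Θ (f^[l] y)) ≤ K * dist (Θ x) (Θ y))
    (hφ : ∀ x ∈ Ω₁, ∀ y ∈ Ω₁, dist (φ x) (φ y) ≤ K * dist (Θ x) (Θ y))
    (hΩ₂ : ∀ x ∈ Ω₂, ∀ l ≤ N, f^[l] x ∈ Ω₁) (hO₂ : O ⊆ Ω₂)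
    (hOA : ∀ x ∈ O, ∀ l ≤ N, f^[l] x ∈ A)
    (hmax : (⋂ n : ℕ, f^[n] '' A) ∩ (⋂ n : ℕ, f^[n] ⁻¹' A) = Λ)
    (hper : ∀ p ∈ Λ, ∀ n : ℕ, 1 ≤ n → f^[n] p = p →
      0 ≤ ∑ k ∈ Finset.range n, φ (f^[k] p))
    (hshadow : ∀ (ι : Type) [Fintype ι] (θ : Equiv.Perm ι) (x : ι → M), (∀ i, x i ∈ Ω₃) →
      (∀ i, dist (Θ (f^[N] (x i))) (Θ (x (θ i))) < δ₃) →
      ∃ p : ι → M, (∀ i, f^[N] (p i) = p (θ i)) ∧ (∀ i, p i ∈ O) ∧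
        ∑ i, dist (Θ (p i)) (Θ (x i)) ≤ K₃ * ∑ i, dist (Θ (f^[N] (x i))) (Θ (x (θ i)))) :
    ∃ δ > 0, ∃ C : ℝ, 0 ≤ C ∧ ∀ (ι : Type) [Fintype ι] (τ : Equiv.Perm ι) (x : ι → M),
      (∀ i, x i ∈ Ω₂ ∩ Ω₃) → (∀ i, dist (Θ (f (x i))) (Θ (x (τ i))) < δ) →
      0 ≤ ∑ i, (φ (x i) + C * dist (Θ (f (x i))) (Θ (x (τ i)))) := by
  have hN' : (0 : ℝ) < N := by exact_mod_cast hN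
  -- `N` jumps, each amplified by `K`, must stay below `δ₃`. In the penalty, the first term pays for
  -- comparing `f^[l] (x i)` with the chain, the second for comparing it with the shadowing orbit.
  refine ⟨δ₃ / (N * K + 1), by positivity, K * (N * K) + K * (K * (K₃ * (N * K))), by positivity,
    fun ι _ τ x hx hjump => ?_⟩
  have hx₁ : ∀ i, x i ∈ Ω₁ := fun i => hΩ₂ _ (hx i).1 0 (Nat.zero_le _)
  have hfx₁ : ∀ i, f (x i) ∈ Ω₁ := fun i => hΩ₂ _ (hx i).1 1 hN
  set E := ∑ i, dist (Θ (f (x i))) (Θ (x (τ i))) with hE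
  have hE0 : 0 ≤ E := Finset.sum_nonneg fun i _ => dist_nonneg
  have hd : ∀ l ≤ N, ∀ i, dist (Θ (f^[l] (x i))) (Θ (x ((τ ^ l) i))) ≤
      ∑ m ∈ Finset.range l, K * dist (Θ (f (x ((τ ^ m) i)))) (Θ (x (τ ((τ ^ m) i)))) :=
    fun l hl i => dist_iterate_le_sum Θ f hlip τ x hx₁ hfx₁ hl i
  have hdsum : ∀ l ≤ N, ∑ i, dist (Θ (f^[l] (x i))) (Θ (x ((τ ^ l) i))) ≤ N * K * E := by
    intro l hl
    refine (Finset.sum_le_sum fun i _ => hd l hl i).trans ?_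
    rw [Finset.sum_comm]
    have h1 : ∀ m ∈ Finset.range l,
        ∑ i, K * dist (Θ (f (x ((τ ^ m) i)))) (Θ (x (τ ((τ ^ m) i)))) = K * E := by
      intro m _
      rw [← Finset.mul_sum,
        Equiv.sum_comp (τ ^ m) (fun i => dist (Θ (f (x i))) (Θ (x (τ i))))]
    rw [Finset.sum_congr rfl h1, Finset.sum_const, Finset.card_range, nsmul_eq_mul, mul_assoc]
    have : (l : ℝ) ≤ N := by exact_mod_cast hl
    gcongr
  -- Every index is used as a starting point for `f^[N]`, along `τ ^ N`. This permutation may split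
  -- into several cycles, so `N` need not divide the length of the chain.
  obtain ⟨p, hp, hpO, hpsum⟩ := hshadow ι (τ ^ N) x (fun i => (hx i).2) (by
    intro i
    refine (hd N le_rfl i).trans_lt ?_
    have h1 : ∑ m ∈ Finset.range N, K * dist (Θ (f (x ((τ ^ m) i)))) (Θ (x (τ ((τ ^ m) i)))) ≤
        N * (K * (δ₃ / (N * K + 1))) := by
      refine (Finset.sum_le_sum fun m _ => mul_le_mul_of_nonneg_left (hjump _).le hK).trans_eq ?_
      rw [Finset.sum_const, Finset.card_range, nsmul_eq_mul]
    refine h1.trans_lt ?_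
    have h2 : N * (K * (δ₃ / (N * K + 1))) = δ₃ * (N * K / (N * K + 1)) := by ring
    rw [h2]
    refine mul_lt_of_lt_one_right hδ₃ ?_
    rw [div_lt_one (by positivity)]
    linarith)
  set m := orderOf (τ ^ N) with hm
  have hm0 : 0 < m := orderOf_pos _
  have hcyc := mem_of_cyclic_orbits f hmax hN (τ ^ N) p hp
    (fun i l hl => hOA _ (hpO i) l hl.le) hm0 (pow_orderOf_eq_one _)
  -- Summed over all starting points, the Birkhoff sums over the common period `N * m` are `m`
  -- copies of the sums of length `N`, because `τ ^ N` only permutes the points.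
  have hpos : 0 ≤ ∑ i, ∑ l ∈ Finset.range N, φ (f^[l] (p i)) := by
    have h1 : 0 ≤ ∑ i, ∑ k ∈ Finset.range (N * m), φ (f^[k] (p i)) :=
      Finset.sum_nonneg fun i _ => hper _ (hcyc i).2.2 _ (Nat.mul_pos hN hm0) (hcyc i).2.1
    have h2 : ∑ i, ∑ k ∈ Finset.range (N * m), φ (f^[k] (p i)) =
        m * ∑ i, ∑ l ∈ Finset.range N, φ (f^[l] (p i)) := by
      simp only [sum_range_mul_eq, fun i q l => (hcyc i).1 q l]
      rw [Finset.sum_comm]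
      have h3 : ∀ q ∈ Finset.range m,
          ∑ i, ∑ l ∈ Finset.range N, φ (f^[l] (p (((τ ^ N) ^ q) i))) =
          ∑ i, ∑ l ∈ Finset.range N, φ (f^[l] (p i)) := fun q _ =>
        Equiv.sum_comp ((τ ^ N) ^ q) fun i => ∑ l ∈ Finset.range N, φ (f^[l] (p i))
      rw [Finset.sum_congr rfl h3, Finset.sum_const, Finset.card_range, nsmul_eq_mul]
    rw [h2] at h1
    exact (mul_nonneg_iff_of_pos_left (by exact_mod_cast hm0)).1 h1
  have hterm : ∀ i, ∀ l ∈ Finset.range N, φ (f^[l] (p i)) ≤ φ (x ((τ ^ l) i)) +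
      (K * dist (Θ (f^[l] (x i))) (Θ (x ((τ ^ l) i))) + K * (K * dist (Θ (p i)) (Θ (x i)))) := by
    intro i l hl
    have hl' : l ≤ N := (Finset.mem_range.1 hl).le
    have hp₂ := hO₂ (hpO i)
    have h1 := hφ _ (hΩ₂ _ hp₂ l hl') _ (hΩ₂ _ (hx i).1 l hl')
    have h2 := hφ _ (hΩ₂ _ (hx i).1 l hl') _ (hx₁ ((τ ^ l) i))
    have h3 := mul_le_mul_of_nonneg_left
      (hlip l hl' _ (hΩ₂ _ hp₂ 0 (Nat.zero_le _)) _ (hx₁ i)) hK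
    simp only [Function.iterate_zero, id] at h3
    rw [Real.dist_eq] at h1 h2
    have h4 := le_abs_self (φ (f^[l] (p i)) - φ (f^[l] (x i)))
    have h5 := le_abs_self (φ (f^[l] (x i)) - φ (x ((τ ^ l) i)))
    linarith
  have hP : ∑ i, dist (Θ (p i)) (Θ (x i)) ≤ K₃ * (N * K * E) :=
    hpsum.trans (mul_le_mul_of_nonneg_left (hdsum N le_rfl) hK₃)
  -- For each `l < N` the indices `(τ ^ l) i` run once through the chain, so its sum is counted `N`
  -- times; this factor is divided out at the end.
  have htotal : ∑ i, ∑ l ∈ Finset.range N, φ (f^[l] (p i)) ≤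
      N * (∑ i, φ (x i) + (K * (N * K * E) + K * (K * (K₃ * (N * K * E))))) := by
    refine (Finset.sum_le_sum fun i _ => Finset.sum_le_sum (hterm i)).trans ?_
    rw [Finset.sum_comm]
    have h1 : ∀ l ∈ Finset.range N, ∑ i, (φ (x ((τ ^ l) i)) +
        (K * dist (Θ (f^[l] (x i))) (Θ (x ((τ ^ l) i))) + K * (K * dist (Θ (p i)) (Θ (x i))))) ≤
        ∑ i, φ (x i) + (K * (N * K * E) + K * (K * (K₃ * (N * K * E)))) := by
      intro l hl
      rw [Finset.sum_add_distrib, Finset.sum_add_distrib, ← Finset.mul_sum, ← Finset.mul_sum,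
        ← Finset.mul_sum, Equiv.sum_comp (τ ^ l) fun i => φ (x i)]
      have := hdsum l (Finset.mem_range.1 hl).le
      gcongr
    refine (Finset.sum_le_sum h1).trans_eq ?_
    rw [Finset.sum_const, Finset.card_range, nsmul_eq_mul]
  have hfin := (mul_nonneg_iff_of_pos_left hN').1 (hpos.trans htotal)
  rw [Finset.sum_add_distrib, ← Finset.mul_sum]
  refine hfin.trans_eq ?_
  ring

/-- Passage from cyclic permutations to finite sequences. -/
theorem closed_chain_sum_nonneg_of_perm (Θ : M → Y) (f : M → M) (φ : M → ℝ) {Ω : Set M} {δ C : ℝ}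
    (h : ∀ (ι : Type) [Fintype ι] (τ : Equiv.Perm ι) (x : ι → M),
      (∀ i, x i ∈ Ω) → (∀ i, dist (Θ (f (x i))) (Θ (x (τ i))) < δ) →
      0 ≤ ∑ i, (φ (x i) + C * dist (Θ (f (x i))) (Θ (x (τ i)))))
    (m : ℕ) (x : ℕ → M) (hx : ∀ i ≤ m, x i ∈ Ω)
    (hj : ∀ i < m, dist (Θ (f (x i))) (Θ (x (i + 1))) < δ)
    (hc : dist (Θ (f (x m))) (Θ (x 0)) < δ) :
    0 ≤ ∑ i ∈ Finset.range m, (φ (x i) + C * dist (Θ (f (x i))) (Θ (x (i + 1)))) +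
      (φ (x m) + C * dist (Θ (f (x m))) (Θ (x 0))) := by
  have hlast : ((finRotate (m + 1) (Fin.last m) : Fin (m + 1)) : ℕ) = 0 := by simp
  have hcast : ∀ i : Fin m, ((finRotate (m + 1) i.castSucc : Fin (m + 1)) : ℕ) = i + 1 := fun i =>
    coe_finRotate_of_ne_last (Fin.castSucc_lt_last i).ne
  have := h (Fin (m + 1)) (finRotate (m + 1)) (fun i => x i)
    (fun i => hx _ (Nat.lt_succ_iff.1 i.2)) (by
      intro i
      refine Fin.lastCases ?_ (fun i => ?_) i
      · simpa only [hlast, Fin.val_last] using hc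
      · simpa only [hcast, Fin.val_castSucc] using hj i i.2)
  rw [Fin.sum_univ_castSucc] at this
  simp only [hlast, Fin.val_last, hcast, Fin.val_castSucc] at this
  rwa [Fin.sum_univ_eq_sum_range
    (fun i => φ (x i) + C * dist (Θ (f (x i))) (Θ (x (i + 1)))) m] at this

end OrbitSums

/-! ### Passage to an iterate, uniform constants and finite cells -/

section Main

variable {d : ℕ} {M : Type*} [TopologicalSpace M]
  [ChartedSpace (EuclideanSpace ℝ (Fin d)) M] [IsManifold (𝓡 d) 1 M]

omit [IsManifold (𝓡 d) 1 M] in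
theorem ContMDiff.iterate_self {f : M → M} (hf : ContMDiff (𝓡 d) (𝓡 d) 1 f) (n : ℕ) :
    ContMDiff (𝓡 d) (𝓡 d) 1 f^[n] := by
  induction n with
  | zero => exact contMDiff_id
  | succ n ih =>
    rw [Function.iterate_succ]
    exact ih.comp hf

omit [IsManifold (𝓡 d) 1 M] in
/-- An invariant family of subspaces is invariant under the iterates. -/
theorem mfderiv_iterate_mem {f : M → M} (hf : ContMDiff (𝓡 d) (𝓡 d) 1 f) {Λ : Set M}
    (hΛ : MapsTo f Λ Λ) {V : ∀ x : M, Submodule ℝ (TangentSpace (𝓡 d) x)}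
    (hV : ∀ x ∈ Λ, ∀ v ∈ V x, mfderiv (𝓡 d) (𝓡 d) f x v ∈ V (f x)) (n : ℕ) :
    ∀ x ∈ Λ, ∀ v ∈ V x, mfderiv (𝓡 d) (𝓡 d) f^[n] x v ∈ V (f^[n] x) := by
  induction n with
  | zero =>
    intro x _ v hv
    have h1 : mfderiv (𝓡 d) (𝓡 d) f^[0] x = ContinuousLinearMap.id ℝ _ := mfderiv_id
    rw [h1]
    exact hv
  | succ n ih =>
    intro x hx v hv
    have h1 : mfderiv (𝓡 d) (𝓡 d) f^[n + 1] x =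
        (mfderiv (𝓡 d) (𝓡 d) f^[n] (f x)).comp (mfderiv (𝓡 d) (𝓡 d) f x) :=
      mfderiv_comp x ((hf.iterate_self n (f x)).mdifferentiableAt one_ne_zero)
        ((hf x).mdifferentiableAt one_ne_zero)
    rw [h1]
    exact ih (f x) (hΛ hx) _ (hV x hx v hv)

/-- Some iterate of a hyperbolic map is hyperbolic in one step. -/
theorem exists_isOneStepHyperbolic_iterate {F : FinslerNorm d M} {f : M → M}
    (hf : ContMDiff (𝓡 d) (𝓡 d) 1 f) {Λ : Set M} (hΛ : MapsTo f Λ Λ)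
    {Eu Es : ∀ x : M, Submodule ℝ (TangentSpace (𝓡 d) x)} {lu ls C : ℝ} (hls : ls < 0)
    (hlu : 0 < lu) (hC : 1 ≤ C)
    (hEu : ∀ x ∈ Λ, ∀ v ∈ Eu x, mfderiv (𝓡 d) (𝓡 d) f x v ∈ Eu (f x))
    (hEs : ∀ x ∈ Λ, ∀ v ∈ Es x, mfderiv (𝓡 d) (𝓡 d) f x v ∈ Es (f x))
    (hs : ∀ x ∈ Λ, ∀ n : ℕ, ∀ v ∈ Es x, F.norm (f^[n] x) (mfderiv (𝓡 d) (𝓡 d) (f^[n]) x v) ≤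
      C * Real.exp (n * ls) * F.norm x v)
    (hu : ∀ x ∈ Λ, ∀ n : ℕ, ∀ v ∈ Eu x, C⁻¹ * Real.exp (n * lu) * F.norm x v ≤
      F.norm (f^[n] x) (mfderiv (𝓡 d) (𝓡 d) (f^[n]) x v))
    {κ : ℝ} (hκ : 0 ≤ κ) :
    ∃ N : ℕ, 0 < N ∧ IsOneStepHyperbolic F Λ Eu Es f^[N] κ := by
  have hC0 : 0 < C := zero_lt_one.trans_le hC
  have h1 : Filter.Tendsto (fun n : ℕ => κ * (C * Real.exp (n * ls))) Filter.atTop (𝓝 0) := by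
    have : Filter.Tendsto (fun n : ℕ => Real.exp (n * ls)) Filter.atTop (𝓝 0) :=
      Real.tendsto_exp_atBot.comp (tendsto_natCast_atTop_atTop.atTop_mul_const_of_neg hls)
    simpa using (this.const_mul C).const_mul κ
  have h2 : Filter.Tendsto (fun n : ℕ => C⁻¹ * Real.exp (n * lu)) Filter.atTop Filter.atTop :=
    Filter.Tendsto.const_mul_atTop (inv_pos.2 hC0)
      (Real.tendsto_exp_atTop.comp (tendsto_natCast_atTop_atTop.atTop_mul_const hlu))
  -- For large `N` the exponential rates absorb both `C` and `κ`.
  obtain ⟨N, ⟨hN1, hN2⟩, hN3⟩ := ((h1.eventually_le_const one_pos).and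
    (h2.eventually_ge_atTop κ)).and (Filter.eventually_gt_atTop 0) |>.exists
  refine ⟨N, hN3, hf.iterate_self N, hΛ.iterate N, mfderiv_iterate_mem hf hΛ hEu N,
    mfderiv_iterate_mem hf hΛ hEs N, fun x hx v hv => ?_, fun x hx v hv => ?_⟩
  · exact (mul_le_mul_of_nonneg_right hN2 (apply_nonneg _ _)).trans (hu x hx N v hv)
  · refine (mul_le_mul_of_nonneg_left (hs x hx N v hv) hκ).trans ?_
    rw [← mul_assoc]
    exact mul_le_of_le_one_left (apply_nonneg _ _) hN1

variable {F : FinslerNorm d M} {Λ : Set M}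

/-- Near `Λ`, the iterates of `f` up to a given order and a Lipschitz function `φ` are Lipschitz
for the distance induced by the separating map. -/
theorem ChartCover.exists_uniform_lipschitz (cov : ChartCover F Λ) (hΛ : IsCompact Λ) {f : M → M}
    (hf : ContMDiff (𝓡 d) (𝓡 d) 1 f) {φ : M → ℝ} (hφ : F.IsLipschitz φ) (N : ℕ) :
    ∃ K : ℝ, 0 ≤ K ∧ ∃ Ω : Set M, IsOpen Ω ∧ Λ ⊆ Ω ∧
      (∀ l ≤ N, ∀ x ∈ Ω, ∀ y ∈ Ω,
        dist (cov.Θ (f^[l] x)) (cov.Θ (f^[l] y)) ≤ K * dist (cov.Θ x) (cov.Θ y)) ∧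
      ∀ x ∈ Ω, ∀ y ∈ Ω, dist (φ x) (φ y) ≤ K * dist (cov.Θ x) (cov.Θ y) := by
  have h1 : ∀ l : ℕ, ∃ A : ℝ, 0 ≤ A ∧ ∃ Ω : Set M, IsOpen Ω ∧ Λ ⊆ Ω ∧ ∀ x ∈ Ω, ∀ y ∈ Ω,
      dist (cov.Θ (f^[l] x)) (cov.Θ (f^[l] y)) ≤ A * dist (cov.Θ x) (cov.Θ y) := fun l =>
    cov.exists_dist_le_of_locally hΛ (h := cov.Θ ∘ f^[l]) fun c _ y hy =>
      (cov.contMDiff.comp (hf.iterate_self l)).exists_dist_le_extChartAt hy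
  choose A hA Ω hΩ hΛΩ hlip using h1
  obtain ⟨B, hB, Ω', hΩ', hΛΩ', hlip'⟩ := cov.exists_dist_le_of_locally hΛ (h := φ)
    fun c _ y hy => hφ.exists_dist_le_extChartAt hy
  have hsum : 0 ≤ ∑ l ∈ Finset.range (N + 1), A l := Finset.sum_nonneg fun l _ => hA l
  refine ⟨B + ∑ l ∈ Finset.range (N + 1), A l, by positivity,
    Ω' ∩ ⋂ l ∈ Finset.range (N + 1), Ω l,
    hΩ'.inter (isOpen_biInter_finset fun l _ => hΩ l),
    subset_inter hΛΩ' (subset_iInter₂ fun l _ => hΛΩ l), ?_, ?_⟩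
  · intro l hl x hx y hy
    have hl' : l ∈ Finset.range (N + 1) := Finset.mem_range.2 (by omega)
    refine (hlip l x (mem_iInter₂.1 hx.2 l hl') y (mem_iInter₂.1 hy.2 l hl')).trans ?_
    refine mul_le_mul_of_nonneg_right ?_ dist_nonneg
    have := Finset.single_le_sum (fun l _ => hA l) hl'
    linarith
  · intro x hx y hy
    refine (hlip' x hx.1 y hy.1).trans (mul_le_mul_of_nonneg_right ?_ dist_nonneg)
    linarith

/-- A finite partition into cells of small diameter near a compact set. -/
theorem exists_finite_cells {Y : Type*} [PseudoMetricSpace Y] {Θ : M → Y} (hΘ : Continuous Θ)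
    (hΛ : IsCompact Λ) {δ : ℝ} (hδ : 0 < δ) :
    ∃ Ω : Set M, IsOpen Ω ∧ Λ ⊆ Ω ∧ ∃ (cell : M → M) (T : Finset M), (∀ x ∈ Ω, cell x ∈ T) ∧
      ∀ x ∈ Ω, ∀ y ∈ Ω, cell x = cell y → dist (Θ x) (Θ y) < δ := by
  have hopen : ∀ c : M, IsOpen {x | dist (Θ x) (Θ c) < δ / 2} := fun c =>
    isOpen_lt (hΘ.dist continuous_const) continuous_const
  obtain ⟨T, -, hT⟩ := hΛ.elim_nhds_subcover (fun c => {x | dist (Θ x) (Θ c) < δ / 2})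
    fun c _ => (hopen c).mem_nhds (by simpa using hδ)
  have h1 : ∀ x : M, ∃ c : M, x ∈ ⋃ c ∈ T, {x | dist (Θ x) (Θ c) < δ / 2} →
      c ∈ T ∧ dist (Θ x) (Θ c) < δ / 2 := by
    intro x
    by_cases hx : x ∈ ⋃ c ∈ T, {x | dist (Θ x) (Θ c) < δ / 2}
    · obtain ⟨c, hc, hxc⟩ := mem_iUnion₂.1 hx
      exact ⟨c, fun _ => ⟨hc, hxc⟩⟩
    · exact ⟨x, fun h => absurd h hx⟩
  choose cell hcell using h1
  refine ⟨_, isOpen_biUnion fun c _ => hopen c, hT, cell, T, fun x hx => (hcell x hx).1,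
    fun x hx y hy hxy => ?_⟩
  have h2 := (hcell x hx).2
  have h3 := (hcell y hy).2
  rw [← hxy] at h3
  have := dist_triangle_right (Θ x) (Θ y) (Θ (cell x))
  linarith

end Main

/-! ### Assembly of the proof -/

theorem mainTheorem2 {d : ℕ} (hd : 2 ≤ d) {M : Type*} [TopologicalSpace M] [T2Space M]
    [ChartedSpace (EuclideanSpace ℝ (Fin d)) M] [IsManifold (𝓡 d) 1 M]
    (F : FinslerNorm d M) (f : M → M) (hf : ContMDiff (𝓡 d) (𝓡 d) 1 f)
    (Λ : Set M) (hΛ : IsHyperbolicSet F f Λ) (hmax : IsLocallyMaximal f Λ)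
    (φ : M → ℝ) (hφ : F.IsLipschitz φ)
    (hper : ∀ p ∈ Λ, ∀ n : ℕ, 1 ≤ n → f^[n] p = p →
      0 ≤ ∑ k ∈ Finset.range n, φ (f^[k] p)) :
    ∃ Ω : Set M, IsOpen Ω ∧ Λ ⊆ Ω ∧ ∃ u : M → ℝ, F.IsLipschitz u ∧
      ∀ x ∈ Ω, 0 ≤ φ x - u (f x) + u x := by
  obtain ⟨hcomp, himage, du, ds, lu, ls, C, Eu, Es, -, -, hdim, hls, hlu, hC, hEu, hEs, hyp⟩ := hΛ
  obtain ⟨U, hU, hΛU, -, hmaxU⟩ := hmax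
  rcases Λ.eq_empty_or_nonempty with rfl | ⟨y₀, hy₀⟩
  · exact ⟨∅, isOpen_empty, Subset.rfl, fun _ => 0, ⟨0, fun x y => by simp⟩, fun x hx => hx.elim⟩
  have hmaps : MapsTo f Λ Λ := fun x hx => himage ▸ mem_image_of_mem f hx
  obtain ⟨cov⟩ := exists_adaptedCover F hcomp hdim hEu hEs fun x hx => (hyp x hx).1
  obtain ⟨N, hN, hg⟩ := exists_isOneStepHyperbolic_iterate (F := F) hf hmaps hls hlu hC
    (fun x hx v hv => by
      have h1 := (hyp x hx).2.1
      have h2 : mfderiv (𝓡 d) (𝓡 d) f x v ∈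
          (mfderiv (𝓡 d) (𝓡 d) f x) '' (Eu x : Set (TangentSpace (𝓡 d) x)) :=
        mem_image_of_mem _ hv
      rwa [h1] at h2)
    (fun x hx => (hyp x hx).2.2.1) (fun x hx n => ((hyp x hx).2.2.2 n).1)
    (fun x hx n => ((hyp x hx).2.2.2 n).2) (κ := 4 * cov.D ^ 2) (by positivity)
  have hfc : ∀ l, Continuous f^[l] := fun l => (hf.iterate_self l).continuous
  have hΘ := cov.contMDiff.continuous
  have hopen : ∀ V : Set M, IsOpen V → IsOpen {x | ∀ l ≤ N, f^[l] x ∈ V} := by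
    intro V hV
    have h1 : {x | ∀ l ≤ N, f^[l] x ∈ V} = ⋂ l ∈ Finset.range (N + 1), f^[l] ⁻¹' V := by
      ext x
      simp
    rw [h1]
    exact isOpen_biInter_finset fun l _ => hV.preimage (hfc l)
  obtain ⟨K, hK, Ω₁, hΩ₁, hΛΩ₁, hlip, hφlip⟩ := cov.exists_uniform_lipschitz hcomp hf hφ N
  let Ω₂ : Set M := {x | ∀ l ≤ N, f^[l] x ∈ Ω₁}
  -- Shadowing controls only the times divisible by `N`. Membership in `O` keeps the intermediate
  -- iterates in `U`, for local maximality, and in `Ω₁`, for the Lipschitz bounds.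
  let O : Set M := Ω₂ ∩ {x | ∀ l ≤ N, f^[l] x ∈ U}
  have hΛΩ₂ : Λ ⊆ Ω₂ := fun x hx l _ => hΛΩ₁ (hmaps.iterate l hx)
  have hΛO : Λ ⊆ O := fun x hx => ⟨hΛΩ₂ hx, fun l _ => hΛU (hmaps.iterate l hx)⟩
  obtain ⟨δ₃, hδ₃, K₃, hK₃, Ω₃, hΩ₃, hΛΩ₃, hshadow⟩ :=
    cov.exists_shadowing hcomp hg ((hopen Ω₁ hΩ₁).inter (hopen U hU)) hΛO
  obtain ⟨δ, hδ, C₀, hC₀, hclosed⟩ := exists_closed_chain_sum_nonneg cov.Θ f φ (Ω₂ := Ω₂)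
    (O := O) hN hK hK₃ hδ₃ hlip hφlip (fun x hx => hx) inter_subset_left
    (fun x hx l hl => subset_closure (hx.2 l hl)) hmaxU hper hshadow
  obtain ⟨Ω₅, hΩ₅, hΛΩ₅, cell, T, hT, hcell⟩ := exists_finite_cells hΘ hcomp (half_pos hδ)
  set Ω := Ω₂ ∩ Ω₃ ∩ Ω₅ with hΩdef
  have hΛΩ : Λ ⊆ Ω := subset_inter (subset_inter hΛΩ₂ hΛΩ₃) hΛΩ₅
  -- Boundedness of `Θ` turns the Lipschitz bound into a lower bound for `φ` on `Ω`.
  have hφb : ∀ x ∈ Ω, -(|φ y₀| + K * cov.R) ≤ φ x := by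
    intro x hx
    have h1 := hφlip y₀ (hΛΩ₁ hy₀) x (hx.1.1 0 (Nat.zero_le _))
    have h2 := mul_le_mul_of_nonneg_left (cov.dist_le y₀ x) hK
    rw [Real.dist_eq] at h1
    linarith [neg_abs_le (φ y₀), le_abs_self (φ y₀ - φ x)]
  have hR := cov.R_nonneg
  obtain ⟨C₁, B, hC₁, hB⟩ := exists_chain_sum_lower_bound cov.Θ f φ hC₀ hδ (by positivity) hφb
    (closed_chain_sum_nonneg_of_perm cov.Θ f φ fun ι _ τ x hx hj =>
      hclosed ι τ x (fun i => (hx i).1) hj)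
    cell T (fun x hx => hT x hx.2) fun x hx y hy => hcell x hx.2 y hy.2
  obtain ⟨u, hu, hsub⟩ := exists_subaction_of_chain_sums_bounded cov.Θ f φ ⟨y₀, hΛΩ hy₀⟩ hC₁ hB
  refine ⟨Ω, ((hopen Ω₁ hΩ₁).inter hΩ₃).inter hΩ₅, hΛΩ, u, ⟨C₁.toNNReal * cov.A, fun x y => ?_⟩,
    fun x hx => by linarith [hsub x hx]⟩
  have h1 : edist (u x) (u y) ≤ C₁.toNNReal * edist (cov.Θ x) (cov.Θ y) := by
    rw [edist_dist, edist_dist, Real.dist_eq]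
    refine (ENNReal.ofReal_le_ofReal (hu x y)).trans_eq ?_
    rw [ENNReal.ofReal_mul hC₁]
    rfl
  refine h1.trans ?_
  rw [ENNReal.coe_mul, mul_assoc]
  exact mul_le_mul_right (cov.edist_le x y) _
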